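/- Notation. For a non-zero window $g\in\mathcal S(\mathbb R^n)$, the short-time Fourier transform of $f\in\mathcal S'(\mathbb R^n)$ is $V_gf(x,\xi)=\langle f,M_\xi T_xg\rangle$, formally $\int_{\mathbb R^n} f(t)\overline{g(t-x)}e^{-2\pi i\xi\cdot t}\,dt$. For $p,q\in[1,\infty]$ and a weight $m$ on $\mathbb R^{2n}$, the modulation space $M^{p,q}_m(\mathbb R^n)$ consists of all $f\in\mathcal S'(\mathbb R^n)$ with $$\|f\|_{M^{p,q}_m}=\Big(\int_{\mathbb R^n}\Big(\int_{\mathbb R^n}|V_gf(x,\xi)|^p\,m(x,\xi)^p\,dx\Big)^{q/p}d\xi\Big)^{1/q}<\infty$$ (with the usual changes if $p=\infty$ or $q=\infty$); $M^{p,q}$ denotes the case $m\equiv1$. Let $v_s(z)=(1+|z|^2)^{s/2}$ for $z\in\mathbb R^{2d}$, and $(1\otimes v_s)(z,\zeta)=v_s(\zeta)$ for $z,\zeta\in\mathbb R^{2d}$. The cross-Wigner distribution $W(f_1,f_2)\in\mathcal S'(\mathbb R^{2d})$ of $f_1,f_2\in\mathcal S'(\mathbb R^d)$ is the extension to tempered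 distributions of $$W(f_1,f_2)(x,\xi)=\int_{\mathbb R^d} f_1\big(x+\tfrac t2\big)\overline{f_2\big(x-\tfrac t2\big)}e^{-2\pi i\xi\cdot t}\,dt .$$ Theorem. Let $p_1,q_1,p_2,q_2,p,q\in[1,\infty]$ satisfy $p_i,q_i\le q$ for $i=1,2$, and $$\frac1{p_1}+\frac1{p_2}\ge\frac1p+\frac1q,\qquad \frac1{q_1}+\frac1{q_2}\ge\frac1p+\frac1q ,$$ let $s\ge0$, and fix non-zero windows $g\in\mathcal S(\mathbb R^d)$ and $\Phi\in\mathcal S(\mathbb R^{2d})$, used to compute the modulation space norms on $\mathbb R^d$ and on $\mathbb R^{2d}$ respectively. Then there is a constant $C\geq 0$ such that for all $f_1\in M^{p_1,q_1}_{v_s}(\mathbb R^d)$ and $f_2\in M^{p_2,q_2}_{v_s}(\mathbb R^d)$ one has $W(f_1,f_2)\in M^{p,q}_{1\otimes v_s}(\mathbb R^{2d})$ and $$\|W(f_1,f_2)\|_{M^{p,q}_{1\otimes v_s}}\le C\Big(\|f_1\|_{M^{p_1,q_1}}\|f_2\|_{M^{p_2,q_2}_{v_s}}+\|f_1\|_{M^{p_1,q_1}_{v_s}}\|f_2\|_{M^{p_2,q_2}}\Big).$$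 -/

import Mathlib

open scoped SchwartzMap ENNReal NNReal

noncomputable section

namespace TimeFreq

open SchwartzMap LineDeriv MeasureTheory
open scoped FourierTransform

section Tensor

variable {V : Type*} [NormedAddCommGroup V] [NormedSpace ℝ V]

theorem fderiv_iteratedFDeriv_apply (Φ : 𝓢(V, ℂ)) (m : V) (n : ℕ) (z : V) :
    fderiv ℝ (iteratedFDeriv ℝ n Φ) z m = iteratedFDeriv ℝ n (∂_{m} Φ : 𝓢(V, ℂ)) z := by
  ext v
  have hc : ∀ (a b : V) (Ψ : 𝓢(V, ℂ)), (∂_{a} (∂_{b} Ψ) : 𝓢(V, ℂ)) = ∂_{b} (∂_{a} Ψ) := by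
    intro a b Ψ
    ext x
    have hs : IsSymmSndFDerivAt ℝ Ψ x :=
      (Ψ.smooth 2).contDiffAt.isSymmSndFDerivAt (by simp)
    have hd : DifferentiableAt ℝ (fderiv ℝ Ψ) x :=
      ((Ψ.smooth 2).fderiv_right (m := 1) (by norm_num)).differentiable (by simp) x
    have h1 : ∀ a b : V, (∂_{a} (∂_{b} Ψ) : 𝓢(V, ℂ)) x = fderiv ℝ (fderiv ℝ Ψ) x a b := by
      intro a b
      rw [lineDerivOp_apply_eq_fderiv]
      have : ((∂_{b} Ψ : 𝓢(V, ℂ)) : V → ℂ) = fun y => fderiv ℝ Ψ y b := by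
        ext y; exact lineDerivOp_apply_eq_fderiv b Ψ y
      rw [this, fderiv_clm_apply hd (by fun_prop)]
      simp
    rw [h1, h1]
    exact hs a b
  have hd : ∀ w : Fin n → V, (∂_{m} (∂^{w} Φ) : 𝓢(V, ℂ)) = ∂^{w} (∂_{m} Φ : 𝓢(V, ℂ)) := by
    intro w
    induction n with
    | zero => simp
    | succ n ih =>
      rw [iteratedLineDerivOp_succ_left, iteratedLineDerivOp_succ_left, hc, ih (Fin.tail w) (Fin.tail w)]
  rw [← iteratedLineDerivOp_eq_iteratedFDeriv, ← hd,
    show fderiv ℝ (iteratedFDeriv ℝ n Φ) z m v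
      = iteratedFDeriv ℝ (n + 1) Φ z (Fin.cons m v) by
        rw [iteratedFDeriv_succ_apply_left]; simp,
    ← iteratedLineDerivOp_eq_iteratedFDeriv, iteratedLineDerivOp_succ_left]
  simp

theorem taylor_norm_le {W : Type*} [NormedAddCommGroup W] [NormedSpace ℝ W] {F : V → W}
    (hF2 : ContDiff ℝ 2 F) {y m : V} {M : ℝ} (hM : 0 ≤ M)
    (hb : ∀ z ∈ Metric.closedBall y ‖m‖, ‖iteratedFDeriv ℝ 2 F z‖ ≤ M) :
    ‖F (y + m) - F y - fderiv ℝ F y m‖ ≤ M * ‖m‖ ^ 2 := by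
  have hF1 : ContDiff ℝ 1 (fderiv ℝ F) := hF2.fderiv_right (by norm_num)
  have hb' : ∀ z ∈ Metric.closedBall y ‖m‖, ‖fderiv ℝ (fderiv ℝ F) z‖ ≤ M := by
    intro z hz
    rw [← norm_iteratedFDeriv_one (𝕜 := ℝ), norm_iteratedFDeriv_fderiv]
    exact hb z hz
  have hconv := convex_closedBall y ‖m‖
  have hy : y ∈ Metric.closedBall y ‖m‖ := by simp
  have hym : y + m ∈ Metric.closedBall y ‖m‖ := by simp
  have h1 : ∀ z ∈ Metric.closedBall y ‖m‖, ‖fderiv ℝ F z - fderiv ℝ F y‖ ≤ M * ‖m‖ := by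
    intro z hz
    refine (hconv.norm_image_sub_le_of_norm_fderiv_le
      (fun w _ => hF1.differentiable (by simp) w) hb' hy hz).trans ?_
    gcongr
    rw [← dist_eq_norm]; exact hz
  have h2 := hconv.norm_image_sub_le_of_norm_fderiv_le'
    (fun w _ => hF2.differentiable (by simp) w) h1 hy hym
  rw [add_sub_cancel_left] at h2
  rw [pow_two, ← mul_assoc]
  exact h2

/-- The Taylor remainder `Φ(· + m) - Φ - ∂_m Φ`. -/
def taylorRem (Φ : 𝓢(V, ℂ)) (m : V) : 𝓢(V, ℂ) :=
  compSubConstCLM ℂ (-m) Φ - Φ - ∂_{m} Φ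

theorem taylorRem_seminorm_le (Φ : 𝓢(V, ℂ)) (k n : ℕ) :
    ∃ C : ℝ, 0 ≤ C ∧ ∀ m : V, ‖m‖ ≤ 1 →
      SchwartzMap.seminorm ℂ k n (taylorRem Φ m) ≤ C * ‖m‖ ^ 2 := by
  set S : ℝ := 2 ^ k * ((Finset.Iic (k, n + 2)).sup
    fun m => SchwartzMap.seminorm ℂ (E := V) (F := ℂ) m.1 m.2) Φ with hS
  have hS0 : 0 ≤ S := by positivity
  refine ⟨2 ^ k * S, by positivity, fun m hm => ?_⟩
  refine SchwartzMap.seminorm_le_bound ℂ k n _ (by positivity) fun y => ?_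
  set F := iteratedFDeriv ℝ n Φ with hF
  have hF2 : ContDiff ℝ 2 F := (Φ.smooth ((2 + n : ℕ) : ℕ∞)).iteratedFDeriv_right (by simp)
  have e : iteratedFDeriv ℝ n (taylorRem Φ m) y = F (y + m) - F y - fderiv ℝ F y m := by
    rw [fderiv_iteratedFDeriv_apply]
    have h1 : (taylorRem Φ m : V → ℂ)
        = ((fun z => Φ (z + m)) - Φ) - (∂_{m} Φ : 𝓢(V, ℂ)) := by
      ext z; simp [taylorRem]
    have c1 : ContDiff ℝ n (fun z => Φ (z + m)) :=
      (Φ.smooth n).comp (contDiff_id.add contDiff_const)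
    rw [h1, iteratedFDeriv_sub_apply (f := (fun z => Φ (z + m)) - (Φ : V → ℂ)) (c1.sub (Φ.smooth n)).contDiffAt
      ((∂_{m} Φ : 𝓢(V, ℂ)).smooth n).contDiffAt,
      iteratedFDeriv_sub_apply c1.contDiffAt (Φ.smooth n).contDiffAt, iteratedFDeriv_comp_add_right]
  have hpos : 0 < (1 + ‖y‖) ^ k := by positivity
  set M : ℝ := 2 ^ k * S / (1 + ‖y‖) ^ k with hM
  have hM0 : 0 ≤ M := by positivity
  have hb : ∀ z ∈ Metric.closedBall y ‖m‖, ‖iteratedFDeriv ℝ 2 F z‖ ≤ M := by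
    intro z hz
    have h1 : ‖iteratedFDeriv ℝ 2 F z‖ = ‖iteratedFDeriv ℝ (n + 2) Φ z‖ := by
      rw [← norm_iteratedFDeriv_fderiv, hF, fderiv_iteratedFDeriv,
        LinearIsometryEquiv.norm_iteratedFDeriv_comp_left, norm_iteratedFDeriv_one,
        norm_fderiv_iteratedFDeriv]
    have h2 := SchwartzMap.one_add_le_sup_seminorm_apply (𝕜 := ℂ) (m := (k, n + 2)) (k := k)
      (n := n + 2) le_rfl le_rfl Φ z
    have h3 : 1 + ‖y‖ ≤ 2 * (1 + ‖z‖) := by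
      have : ‖y‖ ≤ ‖z‖ + ‖z - y‖ := by
        have := norm_sub_le z (z - y); simpa using this
      have h4 : ‖z - y‖ ≤ 1 := by
        rw [← dist_eq_norm]; exact (Metric.mem_closedBall.1 hz).trans hm
      have := norm_nonneg z
      linarith
    rw [h1, hM, le_div_iff₀ hpos]
    calc ‖iteratedFDeriv ℝ (n + 2) Φ z‖ * (1 + ‖y‖) ^ k
        ≤ ‖iteratedFDeriv ℝ (n + 2) Φ z‖ * (2 * (1 + ‖z‖)) ^ k := by gcongr
      _ = 2 ^ k * ((1 + ‖z‖) ^ k * ‖iteratedFDeriv ℝ (n + 2) Φ z‖) := by rw [mul_pow]; ring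
      _ ≤ _ := by gcongr
  have h2 := taylor_norm_le hF2 hM0 hb
  rw [e]
  calc ‖y‖ ^ k * ‖F (y + m) - F y - fderiv ℝ F y m‖
      ≤ (1 + ‖y‖) ^ k * (M * ‖m‖ ^ 2) := by gcongr; linarith
    _ = 2 ^ k * S * ‖m‖ ^ 2 := by rw [hM]; field_simp

theorem taylorRem_sup_le (Φ : 𝓢(V, ℂ)) (s : Finset (ℕ × ℕ)) :
    ∃ C : ℝ, 0 ≤ C ∧ ∀ m : V, ‖m‖ ≤ 1 →
      s.sup (schwartzSeminormFamily ℂ V ℂ) (taylorRem Φ m) ≤ C * ‖m‖ ^ 2 := by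
  choose C hC0 hC using fun i : ℕ × ℕ => taylorRem_seminorm_le Φ i.1 i.2
  refine ⟨∑ i ∈ s, C i, Finset.sum_nonneg fun i _ => hC0 i, fun m hm => ?_⟩
  refine Seminorm.finset_sup_apply_le (by have := Finset.sum_nonneg fun i (_ : i ∈ s) => hC0 i; positivity) fun i hi => ?_
  refine (hC i m hm).trans ?_
  gcongr
  exact Finset.single_le_sum (f := C) (fun i _ => hC0 i) hi

variable {E F G : Type*} [NormedAddCommGroup E] [NormedSpace ℝ E]
  [NormedAddCommGroup F] [NormedSpace ℝ F] [NormedAddCommGroup G] [NormedSpace ℝ G]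

/-- The restriction `Ψ ↦ Ψ(x, ·)`. -/
def sliceCLM (x : E) : 𝓢(E × F, ℂ) →L[ℂ] 𝓢(F, ℂ) :=
  compCLMOfAntilipschitz ℂ (g := fun y : F => (x, y)) (K := 1)
    ((Function.HasTemperateGrowth.const ((x, 0) : E × F)).add
      (ContinuousLinearMap.inr ℝ E F).hasTemperateGrowth |> fun h => by
        convert h using 2; simp)
    (fun y y' => by simp [Prod.edist_eq])

@[simp]
theorem sliceCLM_apply (x : E) (Ψ : 𝓢(E × F, ℂ)) (y : F) : sliceCLM x Ψ y = Ψ (x, y) := rfl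

theorem sliceCLM_seminorm_le (x : E) (Ψ : 𝓢(E × F, ℂ)) (j k n : ℕ) :
    ‖x‖ ^ j * SchwartzMap.seminorm ℂ k n (sliceCLM x Ψ) ≤ SchwartzMap.seminorm ℂ (j + k) n Ψ := by
  rcases (pow_nonneg (norm_nonneg x) j).eq_or_lt with h0 | h0
  · rw [← h0, zero_mul]; positivity
  rw [mul_comm, ← le_div_iff₀ h0]
  refine SchwartzMap.seminorm_le_bound ℂ k n _ (by positivity) fun y => ?_
  rw [le_div_iff₀ h0]
  have e : (sliceCLM x Ψ : F → ℂ)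
      = (fun z => Ψ (z + (x, 0))) ∘ (ContinuousLinearMap.inr ℝ E F) := by
    ext y; simp
  have c1 : ContDiff ℝ n (fun z => Ψ (z + (x, 0))) :=
    (Ψ.smooth n).comp (contDiff_id.add contDiff_const)
  have hn : ‖iteratedFDeriv ℝ n (sliceCLM x Ψ) y‖ ≤ ‖iteratedFDeriv ℝ n Ψ (x, y)‖ := by
    rw [e, ContinuousLinearMap.iteratedFDeriv_comp_right _ c1 y le_rfl,
      iteratedFDeriv_comp_add_right]
    refine (ContinuousMultilinearMap.norm_compContinuousLinearMap_le _ _).trans ?_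
    have h1 : ‖ContinuousLinearMap.inr ℝ E F‖ ≤ 1 := ContinuousLinearMap.norm_inr_le_one ℝ E F
    have h2 : ∏ _i : Fin n, ‖ContinuousLinearMap.inr ℝ E F‖ ≤ 1 :=
      Finset.prod_le_one (fun _ _ => norm_nonneg _) fun _ _ => h1
    simpa using mul_le_of_le_one_right (norm_nonneg _) h2
  calc ‖y‖ ^ k * ‖iteratedFDeriv ℝ n (sliceCLM x Ψ) y‖ * ‖x‖ ^ j
      ≤ ‖(x, y)‖ ^ k * ‖iteratedFDeriv ℝ n Ψ (x, y)‖ * ‖(x, y)‖ ^ j := by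
        gcongr
        · exact norm_snd_le (x, y)
        · exact norm_fst_le (x, y)
    _ = ‖(x, y)‖ ^ (j + k) * ‖iteratedFDeriv ℝ n Ψ (x, y)‖ := by ring
    _ ≤ _ := SchwartzMap.le_seminorm ℂ _ _ _ _

/-- The function `(x, y) ↦ L (Ψ(x, ·)) (y)`. -/
def idTensorFun (L : 𝓢(F, ℂ) →L[ℂ] 𝓢(G, ℂ)) (Ψ : 𝓢(E × F, ℂ)) (z : E × G) : ℂ :=
  L (sliceCLM z.1 Ψ) z.2

theorem exists_seminorm_bound {X Y : Type*} [NormedAddCommGroup X] [NormedSpace ℝ X]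
    [NormedAddCommGroup Y] [NormedSpace ℝ Y] (L : 𝓢(X, ℂ) →L[ℂ] 𝓢(Y, ℂ)) (k : ℕ) :
    ∃ (s : Finset (ℕ × ℕ)) (C : ℝ), 0 ≤ C ∧ ∀ (φ : 𝓢(X, ℂ)) (y : Y),
      ‖y‖ ^ k * ‖L φ y‖ ≤ C * s.sup (schwartzSeminormFamily ℂ X ℂ) φ := by
  obtain ⟨s, C, -, h⟩ := Seminorm.bound_of_continuous (schwartz_withSeminorms ℂ X ℂ)
    ((schwartzSeminormFamily ℂ Y ℂ (k, 0)).comp L.toLinearMap)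
    (((schwartz_withSeminorms ℂ Y ℂ).continuous_seminorm (k, 0)).comp L.continuous)
  refine ⟨s, C, C.2, fun φ y => ?_⟩
  have := SchwartzMap.le_seminorm ℂ k 0 (L φ) y
  rw [norm_iteratedFDeriv_zero] at this
  exact this.trans (h φ)

theorem idTensorFun_bound (L : 𝓢(F, ℂ) →L[ℂ] 𝓢(G, ℂ)) (k : ℕ) :
    ∃ (s : Finset (ℕ × ℕ)) (C : ℝ), 0 ≤ C ∧ ∀ (Ψ : 𝓢(E × F, ℂ)) (z : E × G),
      ‖z‖ ^ k * ‖idTensorFun L Ψ z‖ ≤ C * s.sup (schwartzSeminormFamily ℂ (E × F) ℂ) Ψ := by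
  have key : ∀ j l : ℕ, ∃ (s : Finset (ℕ × ℕ)) (C : ℝ), 0 ≤ C ∧
      ∀ (Ψ : 𝓢(E × F, ℂ)) (z : E × G), ‖z.1‖ ^ j * (‖z.2‖ ^ l * ‖idTensorFun L Ψ z‖)
        ≤ C * s.sup (schwartzSeminormFamily ℂ (E × F) ℂ) Ψ := by
    intro j l
    obtain ⟨s, C, hC, h⟩ := exists_seminorm_bound L l
    refine ⟨s.image fun i => (j + i.1, i.2), C * s.card, by positivity, fun Ψ z => ?_⟩
    calc ‖z.1‖ ^ j * (‖z.2‖ ^ l * ‖idTensorFun L Ψ z‖)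
        ≤ ‖z.1‖ ^ j * (C * ∑ i ∈ s, schwartzSeminormFamily ℂ F ℂ i (sliceCLM z.1 Ψ)) := by
          refine mul_le_mul_of_nonneg_left ((h (sliceCLM z.1 Ψ) z.2).trans ?_) (by positivity)
          gcongr
          refine Seminorm.finset_sup_apply_le (Finset.sum_nonneg fun _ _ => apply_nonneg _ _)
            fun i hi => ?_
          exact Finset.single_le_sum
            (f := fun i => schwartzSeminormFamily ℂ F ℂ i (sliceCLM z.1 Ψ))
            (fun _ _ => apply_nonneg _ _) hi
      _ = C * ∑ i ∈ s, ‖z.1‖ ^ j * schwartzSeminormFamily ℂ F ℂ i (sliceCLM z.1 Ψ) := by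
          rw [Finset.mul_sum, Finset.mul_sum, Finset.mul_sum]
          exact Finset.sum_congr rfl fun i _ => by ring
      _ ≤ C * ∑ i ∈ s, ((s.image fun i => (j + i.1, i.2)).sup
            (schwartzSeminormFamily ℂ (E × F) ℂ)) Ψ := by
          gcongr with i hi
          refine (sliceCLM_seminorm_le z.1 Ψ j i.1 i.2).trans ?_
          exact Finset.le_sup (f := schwartzSeminormFamily ℂ (E × F) ℂ)
            (Finset.mem_image_of_mem (fun i : ℕ × ℕ => (j + i.1, i.2)) hi) Ψ
      _ = _ := by simp; ring
  obtain ⟨s₁, C₁, hC₁, h₁⟩ := key k 0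
  obtain ⟨s₂, C₂, hC₂, h₂⟩ := key 0 k
  refine ⟨s₁ ∪ s₂, C₁ + C₂, by positivity, fun Ψ z => ?_⟩
  have i1 := h₁ Ψ z
  have i2 := h₂ Ψ z
  simp only [pow_zero, one_mul] at i1 i2
  have m1 : s₁.sup (schwartzSeminormFamily ℂ (E × F) ℂ) Ψ
      ≤ (s₁ ∪ s₂).sup (schwartzSeminormFamily ℂ (E × F) ℂ) Ψ :=
    Finset.sup_mono (f := schwartzSeminormFamily ℂ (E × F) ℂ) Finset.subset_union_left Ψ
  have m2 : s₂.sup (schwartzSeminormFamily ℂ (E × F) ℂ) Ψ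
      ≤ (s₁ ∪ s₂).sup (schwartzSeminormFamily ℂ (E × F) ℂ) Ψ :=
    Finset.sup_mono (f := schwartzSeminormFamily ℂ (E × F) ℂ) Finset.subset_union_right Ψ
  have hz : ‖z‖ ^ k ≤ ‖z.1‖ ^ k + ‖z.2‖ ^ k := by
    rw [Prod.norm_def]
    rcases max_choice ‖z.1‖ ‖z.2‖ with h | h <;> rw [h] <;> simp
  calc ‖z‖ ^ k * ‖idTensorFun L Ψ z‖
      ≤ (‖z.1‖ ^ k + ‖z.2‖ ^ k) * ‖idTensorFun L Ψ z‖ := by gcongr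
    _ = ‖z.1‖ ^ k * ‖idTensorFun L Ψ z‖ + ‖z.2‖ ^ k * ‖idTensorFun L Ψ z‖ := by ring
    _ ≤ C₁ * s₁.sup (schwartzSeminormFamily ℂ (E × F) ℂ) Ψ
        + C₂ * s₂.sup (schwartzSeminormFamily ℂ (E × F) ℂ) Ψ := add_le_add i1 i2
    _ ≤ _ := by rw [add_mul]; gcongr

variable [FiniteDimensional ℝ E] [FiniteDimensional ℝ G]

theorem lineDerivOp_inl_eq_sum (Ψ : 𝓢(E × F, ℂ)) (a : E) :
    (∂_{((a, 0) : E × F)} Ψ : 𝓢(E × F, ℂ))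
      = ∑ i, ((Module.finBasis ℝ E).repr a i : ℂ) •
          (∂_{((Module.finBasis ℝ E i, 0) : E × F)} Ψ : 𝓢(E × F, ℂ)) := by
  ext z
  simp only [_root_.sum_apply, _root_.smul_apply, lineDerivOp_apply_eq_fderiv]
  have : ((a, 0) : E × F) = ∑ i, (Module.finBasis ℝ E).repr a i •
      ((Module.finBasis ℝ E i, 0) : E × F) := by
    conv_lhs => rw [← (Module.finBasis ℝ E).sum_repr a]
    ext <;> simp [Prod.fst_sum, Prod.snd_sum]
  rw [this, map_sum]
  simp only [map_smul, Complex.real_smul, smul_eq_mul]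

/-- The coordinates of `E × G` coming from `E`. -/
def coordFst (i : Fin (Module.finrank ℝ E)) : E × G →L[ℝ] ℝ :=
  (LinearMap.toContinuousLinearMap ((Module.finBasis ℝ E).coord i)).comp
    (ContinuousLinearMap.fst ℝ E G)

/-- The coordinates of `E × G` coming from `G`. -/
def coordSnd (i : Fin (Module.finrank ℝ G)) : E × G →L[ℝ] ℝ :=
  (LinearMap.toContinuousLinearMap ((Module.finBasis ℝ G).coord i)).comp
    (ContinuousLinearMap.snd ℝ E G)

theorem hasFDerivAt_idTensorFun (L : 𝓢(F, ℂ) →L[ℂ] 𝓢(G, ℂ)) (Ψ : 𝓢(E × F, ℂ)) (z : E × G) :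
    HasFDerivAt (idTensorFun L Ψ)
      (∑ i, (coordFst i).smulRight
          (idTensorFun L (∂_{((Module.finBasis ℝ E i, 0) : E × F)} Ψ : 𝓢(E × F, ℂ)) z)
        + ∑ i, (coordSnd i).smulRight
          (idTensorFun ((lineDerivOpCLM ℂ 𝓢(G, ℂ) (Module.finBasis ℝ G i)).comp L) Ψ z)) z := by
  obtain ⟨x, y⟩ := z
  set R : E × G → ℂ := fun w => L (sliceCLM x (taylorRem Ψ (w.1 - x, 0))) w.2 with hR
  set φ := L (sliceCLM x Ψ) with hφ
  set ψ : Fin (Module.finrank ℝ E) → 𝓢(G, ℂ) := fun i =>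
    L (sliceCLM x (∂_{((Module.finBasis ℝ E i, 0) : E × F)} Ψ : 𝓢(E × F, ℂ))) with hψ
  have e : idTensorFun L Ψ = fun w => R w + φ w.2
      + ∑ i, (Module.finBasis ℝ E).repr (w.1 - x) i • ψ i w.2 := by
    ext w
    have h1 : sliceCLM w.1 Ψ = sliceCLM x (taylorRem Ψ (w.1 - x, 0)) + sliceCLM x Ψ
        + ∑ i, ((Module.finBasis ℝ E).repr (w.1 - x) i : ℂ) •
          sliceCLM x (∂_{((Module.finBasis ℝ E i, 0) : E × F)} Ψ : 𝓢(E × F, ℂ)) := by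
      have h2 := lineDerivOp_inl_eq_sum Ψ (w.1 - x)
      have h3 : sliceCLM w.1 Ψ = sliceCLM x (compSubConstCLM ℂ (-((w.1 - x, 0) : E × F)) Ψ) := by
        ext t; simp
      rw [h3]
      simp only [taylorRem, map_sub, h2, map_sum, map_smul]
      abel
    simp only [idTensorFun, h1, map_add, map_sum, map_smul, _root_.add_apply,
      _root_.sum_apply, _root_.smul_apply]
    simp [hR, hφ, hψ]
  have hRd : HasFDerivAt R (0 : E × G →L[ℝ] ℂ) (x, y) := by
    refine Asymptotics.IsBigO.hasFDerivAt (n := 2) ?_ (by norm_num)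
    obtain ⟨s, C, hC, h⟩ := exists_seminorm_bound (L.comp (sliceCLM x)) 0
    obtain ⟨C', hC', h'⟩ := taylorRem_sup_le Ψ s
    refine Asymptotics.IsBigO.of_bound (C * C') ?_
    filter_upwards [Metric.ball_mem_nhds (x, y) one_pos] with w hw
    have n1 : ‖((w.1 - x, 0) : E × F)‖ ≤ ‖w - (x, y)‖ := by
      rw [Prod.norm_def]; simpa using norm_fst_le (w - (x, y))
    have n2 : ‖w - (x, y)‖ ≤ 1 := by
      rw [← dist_eq_norm]; exact (Metric.mem_ball.1 hw).le
    have b1 := h (taylorRem Ψ (w.1 - x, 0)) w.2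
    rw [pow_zero, one_mul] at b1
    refine b1.trans ?_
    rw [norm_pow, norm_norm, mul_assoc]
    gcongr
    refine (h' _ (n1.trans n2)).trans ?_
    gcongr
  have hφd : HasFDerivAt (fun w : E × G => φ w.2)
      ((fderiv ℝ φ y).comp (ContinuousLinearMap.snd ℝ E G)) (x, y) :=
    HasFDerivAt.comp (x, y) (φ.hasFDerivAt y) hasFDerivAt_snd
  have hψd : ∀ i, HasFDerivAt (fun w : E × G => (Module.finBasis ℝ E).repr (w.1 - x) i • ψ i w.2)
      ((coordFst i).smulRight (ψ i y)) (x, y) := by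
    intro i
    have a1 : HasFDerivAt (fun w : E × G => (Module.finBasis ℝ E).repr (w.1 - x) i)
        (coordFst i) (x, y) := by
      simpa [coordFst] using ((coordFst (G := G) i).hasFDerivAt (x := (x, y))).sub_const
        (coordFst i (x, y))
    have a2 : HasFDerivAt (fun w : E × G => ψ i w.2)
        ((fderiv ℝ (ψ i) y).comp (ContinuousLinearMap.snd ℝ E G)) (x, y) :=
      HasFDerivAt.comp (x, y) ((ψ i).hasFDerivAt y) hasFDerivAt_snd
    have := a1.fun_smul a2
    refine this.congr_fderiv ?_
    simp
  have hsum := (hRd.fun_add hφd).fun_add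
    (HasFDerivAt.fun_sum (u := Finset.univ) fun i _ => hψd i)
  rw [← e] at hsum
  refine hsum.congr_fderiv ?_
  rw [zero_add, add_comm]
  congr 1
  ext v
  · simp [coordSnd]
  · have hv : fderiv ℝ φ y v = ∑ i, (Module.finBasis ℝ G).repr v i •
        fderiv ℝ φ y (Module.finBasis ℝ G i) := by
      conv_lhs => rw [← (Module.finBasis ℝ G).sum_repr v]
      rw [map_sum]
      simp only [map_smul]
    simp only [ContinuousLinearMap.comp_apply, ContinuousLinearMap.inr_apply,
      ContinuousLinearMap.coe_snd', hv, _root_.sum_apply]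
    simp [coordSnd, idTensorFun, lineDerivOp_apply_eq_fderiv, hφ]

theorem contDiff_idTensorFun (n : ℕ) : ∀ (L : 𝓢(F, ℂ) →L[ℂ] 𝓢(G, ℂ)) (Ψ : 𝓢(E × F, ℂ)),
    ContDiff ℝ n (idTensorFun (E := E) L Ψ) := by
  induction n with
  | zero =>
    intro L Ψ
    exact contDiff_zero.2 (Differentiable.continuous (𝕜 := ℝ)
      fun z => (hasFDerivAt_idTensorFun L Ψ z).differentiableAt)
  | succ n ih =>
    intro L Ψ
    refine (contDiff_succ_iff_fderiv (n := n)).2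
      ⟨fun z => (hasFDerivAt_idTensorFun L Ψ z).differentiableAt, by simp, ?_⟩
    have e : fderiv ℝ (idTensorFun (E := E) L Ψ) = fun z => _ :=
      funext fun z => (hasFDerivAt_idTensorFun L Ψ z).fderiv
    rw [e]
    refine ContDiff.add (ContDiff.sum fun i _ => ?_) (ContDiff.sum fun i _ => ?_)
    · exact contDiff_const.smulRight (ih _ _)
    · exact contDiff_const.smulRight (ih _ _)

theorem sum_seminorm_bound {X Y ι : Type*} [NormedAddCommGroup X] [NormedSpace ℝ X]
    (t : Finset ι) (a : ι → 𝓢(X, ℂ) → Y → ℝ)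
    (h : ∀ i, ∃ (s : Finset (ℕ × ℕ)) (C : ℝ), 0 ≤ C ∧ ∀ (Ψ : 𝓢(X, ℂ)) (z : Y),
      a i Ψ z ≤ C * s.sup (schwartzSeminormFamily ℂ X ℂ) Ψ) :
    ∃ (s : Finset (ℕ × ℕ)) (C : ℝ), 0 ≤ C ∧ ∀ (Ψ : 𝓢(X, ℂ)) (z : Y),
      ∑ i ∈ t, a i Ψ z ≤ C * s.sup (schwartzSeminormFamily ℂ X ℂ) Ψ := by
  choose s C hC h using h
  refine ⟨t.biUnion s, ∑ i ∈ t, C i, Finset.sum_nonneg fun i _ => hC i, fun Ψ z => ?_⟩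
  rw [Finset.sum_mul]
  refine Finset.sum_le_sum fun i hi => (h i Ψ z).trans ?_
  refine mul_le_mul_of_nonneg_left ?_ (hC i)
  exact Finset.sup_mono (f := schwartzSeminormFamily ℂ X ℂ)
    (Finset.subset_biUnion_of_mem s hi) Ψ

theorem iteratedFDeriv_idTensorFun_bound (n k : ℕ) : ∀ (L : 𝓢(F, ℂ) →L[ℂ] 𝓢(G, ℂ)),
    ∃ (s : Finset (ℕ × ℕ)) (C : ℝ), 0 ≤ C ∧ ∀ (Ψ : 𝓢(E × F, ℂ)) (z : E × G),
      ‖z‖ ^ k * ‖iteratedFDeriv ℝ n (idTensorFun L Ψ) z‖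
        ≤ C * s.sup (schwartzSeminormFamily ℂ (E × F) ℂ) Ψ := by
  induction n with
  | zero =>
    intro L
    simpa only [norm_iteratedFDeriv_zero] using idTensorFun_bound L k
  | succ n ih =>
    intro L
    let A : Fin (Module.finrank ℝ E) → 𝓢(E × F, ℂ) → E × G → ℂ := fun i Ψ =>
      idTensorFun L (∂_{((Module.finBasis ℝ E i, 0) : E × F)} Ψ : 𝓢(E × F, ℂ))
    let B : Fin (Module.finrank ℝ G) → 𝓢(E × F, ℂ) → E × G → ℂ := fun i Ψ =>
      idTensorFun ((lineDerivOpCLM ℂ 𝓢(G, ℂ) (Module.finBasis ℝ G i)).comp L) Ψ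
    have hA : ∀ i, ∃ (s : Finset (ℕ × ℕ)) (C : ℝ), 0 ≤ C ∧ ∀ (Ψ : 𝓢(E × F, ℂ)) (z : E × G),
        ‖ContinuousLinearMap.smulRightL ℝ (E × G) ℂ (coordFst i)‖ *
          (‖z‖ ^ k * ‖iteratedFDeriv ℝ n (A i Ψ) z‖)
          ≤ C * s.sup (schwartzSeminormFamily ℂ (E × F) ℂ) Ψ := by
      intro i
      obtain ⟨s, C, hC, h⟩ := ih L
      have hcont : Continuous fun Ψ => (s.sup (schwartzSeminormFamily ℂ (E × F) ℂ)) Ψ :=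
        Seminorm.continuous_finsetSup fun i _ =>
          (schwartz_withSeminorms ℂ (E × F) ℂ).continuous_seminorm i
      let D := lineDerivOpCLM ℂ 𝓢(E × F, ℂ) ((Module.finBasis ℝ E i, 0) : E × F)
      obtain ⟨s', C', -, h'⟩ := Seminorm.bound_of_continuous (schwartz_withSeminorms ℂ (E × F) ℂ)
        ((s.sup (schwartzSeminormFamily ℂ (E × F) ℂ)).comp D.toLinearMap)
        (hcont.comp D.continuous)
      refine ⟨s', ‖ContinuousLinearMap.smulRightL ℝ (E × G) ℂ (coordFst i)‖ * (C * C'),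
        by positivity, fun Ψ z => ?_⟩
      rw [mul_assoc]
      refine mul_le_mul_of_nonneg_left ((h _ z).trans ?_) (by positivity)
      rw [mul_assoc]
      exact mul_le_mul_of_nonneg_left (h' Ψ) hC
    have hB : ∀ i, ∃ (s : Finset (ℕ × ℕ)) (C : ℝ), 0 ≤ C ∧ ∀ (Ψ : 𝓢(E × F, ℂ)) (z : E × G),
        ‖ContinuousLinearMap.smulRightL ℝ (E × G) ℂ (coordSnd i)‖ *
          (‖z‖ ^ k * ‖iteratedFDeriv ℝ n (B i Ψ) z‖)
          ≤ C * s.sup (schwartzSeminormFamily ℂ (E × F) ℂ) Ψ := by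
      intro i
      obtain ⟨s, C, hC, h⟩ := ih ((lineDerivOpCLM ℂ 𝓢(G, ℂ) (Module.finBasis ℝ G i)).comp L)
      refine ⟨s, ‖ContinuousLinearMap.smulRightL ℝ (E × G) ℂ (coordSnd i)‖ * C,
        by positivity, fun Ψ z => ?_⟩
      rw [mul_assoc]
      exact mul_le_mul_of_nonneg_left (h Ψ z) (by positivity)
    obtain ⟨s, C, hC, h⟩ := sum_seminorm_bound Finset.univ
      (fun j : Fin (Module.finrank ℝ E) ⊕ Fin (Module.finrank ℝ G) => fun Ψ z => Sum.elim
        (fun i => ‖ContinuousLinearMap.smulRightL ℝ (E × G) ℂ (coordFst i)‖ *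
          (‖z‖ ^ k * ‖iteratedFDeriv ℝ n (A i Ψ) z‖))
        (fun i => ‖ContinuousLinearMap.smulRightL ℝ (E × G) ℂ (coordSnd i)‖ *
          (‖z‖ ^ k * ‖iteratedFDeriv ℝ n (B i Ψ) z‖)) j)
      (fun j => by rcases j with i | i; exacts [hA i, hB i])
    refine ⟨s, C, hC, fun Ψ z => le_trans ?_ (h Ψ z)⟩
    have cA : ∀ i, ContDiff ℝ n (A i Ψ) := fun i => contDiff_idTensorFun n _ _
    have cB : ∀ i, ContDiff ℝ n (B i Ψ) := fun i => contDiff_idTensorFun n _ _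
    have e : fderiv ℝ (idTensorFun (E := E) L Ψ) = fun z =>
        ∑ j : Fin (Module.finrank ℝ E) ⊕ Fin (Module.finrank ℝ G), Sum.elim
          (fun i => (ContinuousLinearMap.smulRightL ℝ (E × G) ℂ (coordFst i) ∘ A i Ψ) z)
          (fun i => (ContinuousLinearMap.smulRightL ℝ (E × G) ℂ (coordSnd i) ∘ B i Ψ) z) j := by
      funext z
      rw [(hasFDerivAt_idTensorFun L Ψ z).fderiv, Fintype.sum_sum_type]
      rfl
    rw [← norm_iteratedFDeriv_fderiv, e, iteratedFDeriv_fun_sum_apply]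
    · have hk : 0 ≤ ‖z‖ ^ k := by positivity
      refine (mul_le_mul_of_nonneg_left (norm_sum_le _ _) hk).trans ?_
      rw [Fintype.sum_sum_type]
      rw [Fintype.sum_sum_type, mul_add, Finset.mul_sum, Finset.mul_sum]
      refine add_le_add (Finset.sum_le_sum fun i _ => ?_) (Finset.sum_le_sum fun i _ => ?_)
      · simp only [Sum.elim_inl]
        rw [mul_left_comm]
        exact mul_le_mul_of_nonneg_left (ContinuousLinearMap.norm_iteratedFDeriv_comp_left _
          (cA i).contDiffAt le_rfl) (by positivity)
      · simp only [Sum.elim_inr]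
        rw [mul_left_comm]
        exact mul_le_mul_of_nonneg_left (ContinuousLinearMap.norm_iteratedFDeriv_comp_left _
          (cB i).contDiffAt le_rfl) (by positivity)
    · rintro (i | i) -
      · exact ((ContinuousLinearMap.contDiff _).comp (cA i)).contDiffAt
      · exact ((ContinuousLinearMap.contDiff _).comp (cB i)).contDiffAt

/-- The operator `id ⊗ L`, i.e. `Ψ ↦ ((x, y) ↦ L (Ψ(x, ·)) (y))`. -/
def idTensorCLM (L : 𝓢(F, ℂ) →L[ℂ] 𝓢(G, ℂ)) : 𝓢(E × F, ℂ) →L[ℂ] 𝓢(E × G, ℂ) :=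
  mkCLM (idTensorFun L) (fun _ _ _ => by simp [idTensorFun]) (fun _ _ _ => by simp [idTensorFun])
    (fun Ψ => contDiff_infty.2 fun n => contDiff_idTensorFun n L Ψ)
    (fun i => iteratedFDeriv_idTensorFun_bound i.2 i.1 L)

@[simp]
theorem idTensorCLM_apply (L : 𝓢(F, ℂ) →L[ℂ] 𝓢(G, ℂ)) (Ψ : 𝓢(E × F, ℂ)) (x : E) (y : G) :
    idTensorCLM L Ψ (x, y) = L (sliceCLM x Ψ) y := rfl

/-- The constant functions on a point, as Schwartz functions. -/
def constPoint : ℂ →L[ℂ] 𝓢(PUnit.{1}, ℂ) :=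
  LinearMap.toContinuousLinearMap
    { toFun := fun c =>
        { toFun := fun _ => c
          smooth' := contDiff_const
          decay' := fun k n => ⟨‖(0 : PUnit.{1})‖ ^ k * ‖iteratedFDeriv ℝ n (fun _ : PUnit.{1} => c) 0‖,
            fun x => by rw [Subsingleton.elim x 0]⟩ }
      map_add' := fun _ _ => rfl
      map_smul' := fun _ _ => rfl }

/-- The partial action of a distribution `h` on the second variable: `Ψ ↦ (x ↦ h(Ψ(x, ·)))`. -/
def contractSnd (h : 𝓢'(F, ℂ)) : 𝓢(E × F, ℂ) →L[ℂ] 𝓢(E, ℂ) :=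
  (compCLMOfContinuousLinearEquiv ℂ (ContinuousLinearEquiv.prodUnique ℝ E PUnit.{1}).symm).comp
    (idTensorCLM (constPoint.comp
      (⟨h.toLinearMap, h.continuous⟩ : 𝓢(F, ℂ) →L[ℂ] ℂ)))

@[simp]
theorem contractSnd_apply (h : 𝓢'(F, ℂ)) (Ψ : 𝓢(E × F, ℂ)) (x : E) :
    contractSnd h Ψ x = h (sliceCLM x Ψ) := rfl

/-- The tensor product of two tempered distributions, `(f ⊗ h)(Ψ) = f(x ↦ h(Ψ(x, ·)))`. -/
def tensorDistrib (f : 𝓢'(E, ℂ)) (h : 𝓢'(F, ℂ)) : 𝓢'(E × F, ℂ) :=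
  ContinuousLinearMap.toPointwiseConvergenceCLM _ _ _ _
    ((⟨f.toLinearMap, f.continuous⟩ : 𝓢(E, ℂ) →L[ℂ] ℂ).comp (contractSnd h))

@[simp]
theorem tensorDistrib_apply (f : 𝓢'(E, ℂ)) (h : 𝓢'(F, ℂ)) (Ψ : 𝓢(E × F, ℂ)) :
    tensorDistrib f h Ψ = f (contractSnd h Ψ) := rfl

end Tensor

section Conj

variable {V : Type*} [NormedAddCommGroup V] [NormedSpace ℝ V]

/-- Complex conjugation of Schwartz functions. -/
def conjSchwartz : 𝓢(V, ℂ) →L[ℝ] 𝓢(V, ℂ) :=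
  postcompCLM (Complex.conjCLE : ℂ →L[ℝ] ℂ)

@[simp]
theorem conjSchwartz_apply (φ : 𝓢(V, ℂ)) (x : V) :
    conjSchwartz φ x = starRingEnd ℂ (φ x) := rfl

/-- The complex conjugate of a tempered distribution. -/
def conjDistrib (f : 𝓢'(V, ℂ)) : 𝓢'(V, ℂ) :=
  ContinuousLinearMap.toPointwiseConvergenceCLM _ _ _ _
    { toFun := fun φ => starRingEnd ℂ (f (conjSchwartz φ))
      map_add' := fun φ ψ => by simp
      map_smul' := fun c φ => by
        have : conjSchwartz (c • φ) = starRingEnd ℂ c • conjSchwartz φ := by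
          ext x; simp
        simp [this]
      cont := Complex.continuous_conj.comp (f.continuous.comp conjSchwartz.continuous) }

@[simp]
theorem conjDistrib_apply (f : 𝓢'(V, ℂ)) (φ : 𝓢(V, ℂ)) :
    conjDistrib f φ = starRingEnd ℂ (f (conjSchwartz φ)) := rfl

end Conj

section STFT

variable {V : Type*} [NormedAddCommGroup V] [InnerProductSpace ℝ V]

/-- The character `t ↦ exp(2πi ξ·t)`. -/
def character (ξ t : V) : ℂ := Complex.exp (2 * Real.pi * Complex.I * (inner ℝ ξ t : ℝ))

theorem hasTemperateGrowth_character (ξ : V) : (character ξ).HasTemperateGrowth := by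
  have h1 : Function.HasTemperateGrowth
      (fun t : ℝ => Complex.exp (2 * Real.pi * Complex.I * (t : ℂ))) := by
    have hd : ∀ n : ℕ, iteratedDeriv n
        (fun t : ℝ => Complex.exp (2 * Real.pi * Complex.I * (t : ℂ))) = fun t : ℝ =>
          (2 * Real.pi * Complex.I) ^ n * Complex.exp (2 * Real.pi * Complex.I * (t : ℂ)) := by
      intro n
      induction n with
      | zero => simp
      | succ n ih =>
        rw [iteratedDeriv_succ, ih]
        ext t
        have h2 : HasDerivAt (fun t : ℝ => 2 * Real.pi * Complex.I * (t : ℂ))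
            (2 * Real.pi * Complex.I) t := by
          simpa using (Complex.ofRealCLM.hasDerivAt (x := t)).const_mul (2 * Real.pi * Complex.I)
        rw [(h2.cexp.const_mul _).deriv]
        ring
    refine ⟨?_, fun n => ⟨0, (2 * Real.pi) ^ n, fun x => ?_⟩⟩
    · exact Complex.contDiff_exp.comp (contDiff_const.mul Complex.ofRealCLM.contDiff)
    · rw [norm_iteratedFDeriv_eq_norm_iteratedDeriv, hd]
      have : ‖Complex.exp (2 * Real.pi * Complex.I * (x : ℂ))‖ = 1 := by
        rw [show (2 * Real.pi * Complex.I * (x : ℂ)) = ((2 * Real.pi * x : ℝ) : ℂ) * Complex.I by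
          push_cast; ring, Complex.norm_exp_ofReal_mul_I]
      simp [this, abs_of_pos Real.pi_pos]
  exact h1.comp (Function.hasTemperateGrowth_inner_right ξ)

/-- The time-frequency shift `M_ξ T_x g`, i.e. `t ↦ exp(2πi ξ·t) g(t - x)`. -/
def timeFreqShift (x ξ : V) (g : 𝓢(V, ℂ)) : 𝓢(V, ℂ) :=
  smulLeftCLM ℂ (character ξ) (compSubConstCLM ℂ x g)

@[simp]
theorem timeFreqShift_apply (x ξ : V) (g : 𝓢(V, ℂ)) (t : V) :
    timeFreqShift x ξ g t = character ξ t * g (t - x) := by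
  simp [timeFreqShift, smulLeftCLM_apply_apply (hasTemperateGrowth_character ξ)]

/-- The short-time Fourier transform `V_g f(x, ξ) = ⟨f, M_ξ T_x g⟩` (the pairing being conjugate
linear in the second slot), formally `∫ f(t) conj(g(t - x)) exp(-2πi ξ·t) dt`. -/
def stft (g : 𝓢(V, ℂ)) (f : 𝓢'(V, ℂ)) (x ξ : V) : ℂ :=
  f (conjSchwartz (timeFreqShift x ξ g))

variable [FiniteDimensional ℝ V] [MeasurableSpace V] [BorelSpace V]

/-- The weighted mixed norm of `L^{p,q}_m`: the `L^p` norm in `x`, then the `L^q` norm in `ξ`. -/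
def mixedNorm (p q : ℝ≥0∞) (m : V → V → ℝ) (F : V → V → ℂ) : ℝ≥0∞ :=
  eLpNorm (fun ξ => eLpNorm (fun x => F x ξ * (m x ξ : ℂ)) p volume) q volume

/-- The norm of `M^{p,q}_m`, computed with the window `g`; it is `∞` outside of the space. -/
def modulationNorm (g : 𝓢(V, ℂ)) (p q : ℝ≥0∞) (m : V → V → ℝ) (f : 𝓢'(V, ℂ)) : ℝ≥0∞ :=
  mixedNorm p q m (stft g f)

/-- The modulation space `M^{p,q}_m`, described with the window `g`. The function `stft g f` is
continuous for every tempered distribution `f`, so that membership is finiteness of the norm. -/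
def modulationSpace (g : 𝓢(V, ℂ)) (p q : ℝ≥0∞) (m : V → V → ℝ) : Set 𝓢'(V, ℂ) :=
  {f | modulationNorm g p q m f < ⊤}

end STFT

section Weights

variable {V : Type*} [NormedAddCommGroup V] [InnerProductSpace ℝ V]

/-- `⟨z⟩^s = (1 + |z|²)^{s/2}`. -/
def japaneseBracket (s : ℝ) (z : V) : ℝ := (1 + ‖z‖ ^ 2) ^ (s / 2)

/-- The constant weight `1`. -/
def oneWeight (_ _ : V) : ℝ := 1

/-- The weight `v_s(x, ξ) = (1 + |x|² + |ξ|²)^{s/2}`. -/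
def vWeight (s : ℝ) (x ξ : V) : ℝ := japaneseBracket s (WithLp.toLp 2 (x, ξ))

/-- The weight `(1 ⊗ v_s)(z, ζ) = v_s(ζ)`. -/
def oneTensorWeight (s : ℝ) (_ ζ : V) : ℝ := japaneseBracket s ζ

end Weights

section Wigner

variable {E : Type*} [NormedAddCommGroup E] [InnerProductSpace ℝ E]

/-- The linear change of variables `(u, v) ↦ ((u + v)/2, u - v)`, with inverse
`(x, t) ↦ (x + t/2, x - t/2)`. -/
def wignerCoord : (E × E) ≃L[ℝ] (E × E) :=
  ContinuousLinearEquiv.equivOfInverse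
    (((2⁻¹ : ℝ) • (ContinuousLinearMap.fst ℝ E E + ContinuousLinearMap.snd ℝ E E)).prod
      (ContinuousLinearMap.fst ℝ E E - ContinuousLinearMap.snd ℝ E E))
    ((ContinuousLinearMap.fst ℝ E E + (2⁻¹ : ℝ) • ContinuousLinearMap.snd ℝ E E).prod
      (ContinuousLinearMap.fst ℝ E E - (2⁻¹ : ℝ) • ContinuousLinearMap.snd ℝ E E))
    (fun z => by ext <;> simp <;> module)
    (fun z => by ext <;> simp <;> module)

@[simp]
theorem wignerCoord_apply (u v : E) : wignerCoord (u, v) = ((2⁻¹ : ℝ) • (u + v), u - v) := rfl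

variable [FiniteDimensional ℝ E] [MeasurableSpace E] [BorelSpace E]

/-- The partial Fourier transform in the second variable,
`(x, t) ↦ ∫ Ψ(x, ξ) exp(-2πi ξ·t) dξ`. -/
def partialFourier : 𝓢(E × E, ℂ) →L[ℂ] 𝓢(E × E, ℂ) :=
  idTensorCLM (fourierTransformCLM ℂ)

theorem partialFourier_apply (Ψ : 𝓢(E × E, ℂ)) (x t : E) :
    partialFourier Ψ (x, t)
      = ∫ ξ, Complex.exp (-2 * Real.pi * Complex.I * (inner ℝ ξ t : ℝ)) * Ψ (x, ξ) := by
  change 𝓕 (sliceCLM x Ψ : E → ℂ) t = _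
  rw [Real.fourier_eq']
  refine integral_congr_ae (Filter.Eventually.of_forall fun ξ => ?_)
  simp only [sliceCLM_apply, smul_eq_mul]
  congr 2
  push_cast
  ring

/-- The operator on test functions transposed to `f₁ ⊗ conj f₂ ↦ W(f₁, f₂)`:
`Ψ ↦ ((u, v) ↦ ∫ Ψ((u + v)/2, ξ) exp(-2πi ξ·(u - v)) dξ)`. -/
def wignerTranspose : 𝓢(WithLp 2 (E × E), ℂ) →L[ℂ] 𝓢(E × E, ℂ) :=
  (compCLMOfContinuousLinearEquiv ℂ wignerCoord).comp
    (partialFourier.comp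
      (compCLMOfContinuousLinearEquiv ℂ (WithLp.prodContinuousLinearEquiv 2 ℝ E E).symm))

theorem wignerTranspose_apply (Ψ : 𝓢(WithLp 2 (E × E), ℂ)) (u v : E) :
    wignerTranspose Ψ (u, v)
      = ∫ ξ, Complex.exp (-2 * Real.pi * Complex.I * (inner ℝ ξ (u - v) : ℝ)) *
        Ψ (WithLp.toLp 2 ((2⁻¹ : ℝ) • (u + v), ξ)) :=
  partialFourier_apply _ _ _

/-- The cross-Wigner distribution of two tempered distributions: the extension to
`𝓢' × 𝓢' → 𝓢'` of `W(f₁, f₂)(x, ξ) = ∫ f₁(x + t/2) conj(f₂(x - t/2)) exp(-2πi ξ·t) dt`.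
Testing this function against `Ψ` and substituting `u = x + t/2`, `v = x - t/2` gives
`∬ f₁(u) conj(f₂(v)) (wignerTranspose Ψ)(u, v) du dv`. -/
def crossWigner (f₁ f₂ : 𝓢'(E, ℂ)) : 𝓢'(WithLp 2 (E × E), ℂ) :=
  ContinuousLinearMap.toPointwiseConvergenceCLM _ _ _ _
    ((⟨(tensorDistrib f₁ (conjDistrib f₂)).toLinearMap,
      (tensorDistrib f₁ (conjDistrib f₂)).continuous⟩ : 𝓢(E × E, ℂ) →L[ℂ] ℂ).comp wignerTranspose)

theorem crossWigner_apply (f₁ f₂ : 𝓢'(E, ℂ)) (Ψ : 𝓢(WithLp 2 (E × E), ℂ)) :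
    crossWigner f₁ f₂ Ψ = tensorDistrib f₁ (conjDistrib f₂) (wignerTranspose Ψ) := rfl

end Wigner

end TimeFreq

end

/-!
With `W(g, g)` as window, the short-time Fourier transform of `W(f₁, f₂)` factorises:
`|V_{W(g, g)} W(f₁, f₂)(z, ζ)| = |V_g f₁ (z - Jζ/2)| |V_g f₂ (z + Jζ/2)|` with `J (x, ξ) = (ξ, -x)`.
Raised to the power `p` and integrated over `z`, the right-hand side is a correlation evaluated at
`Jζ`, so for `p ≤ q` Young's inequality for mixed norms bounds its `L^{p,q}` norm whenever
`1/p₁ + 1/p₂ = 1/q₁ + 1/q₂ = 1/p + 1/q` and `p ≤ pᵢ, qᵢ`. The weight enters through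
`v_s(ζ) ≤ 2^s (v_s(z - Jζ/2) + v_s(z + Jζ/2))`. Arbitrary exponents are reduced to these by the
inclusions between modulation spaces. The inclusions, like the independence of the norms from the
window, hold because the transform for one window is dominated by the convolution of the transform
for another with a rapidly decaying kernel, to which Young's inequality applies again.
-/

namespace TimeFreq

open SchwartzMap LineDeriv MeasureTheory
open scoped FourierTransform

section MixedNorms

variable {α β : Type*} [MeasurableSpace α] [MeasurableSpace β] {μ : Measure α} {ν : Measure β}

theorem eLpNorm_rpow_toReal {p : ℝ≥0∞} (h0 : p ≠ 0) (ht : p ≠ ∞) (f : α → ℝ≥0∞) :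
    eLpNorm f p μ ^ p.toReal = ∫⁻ x, f x ^ p.toReal ∂μ := by
  simp only [eLpNorm_eq_lintegral_rpow_enorm_toReal h0 ht, enorm_eq_self, one_div,
    ENNReal.rpow_inv_rpow (ENNReal.toReal_pos h0 ht).ne']

theorem eLpNorm_eq_lintegral_rpow_toReal {p : ℝ≥0∞} (h0 : p ≠ 0) (ht : p ≠ ∞) (f : α → ℝ≥0∞) :
    eLpNorm f p μ = (∫⁻ x, f x ^ p.toReal ∂μ) ^ p.toReal⁻¹ := by
  rw [← eLpNorm_rpow_toReal h0 ht, ENNReal.rpow_rpow_inv (ENNReal.toReal_pos h0 ht).ne']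

theorem eLpNorm_top_le_iff {f : α → ℝ≥0∞} {c : ℝ≥0∞} :
    eLpNorm f ∞ μ ≤ c ↔ ∀ᵐ x ∂μ, f x ≤ c := by
  rw [eLpNorm_exponent_top, eLpNormEssSup_eq_essSup_enorm]
  exact ⟨fun h => (ae_le_essSup (μ := μ) (f := f)).mono fun x hx => hx.trans h,
    essSup_le_of_ae_le c⟩

theorem ae_le_eLpNorm_top (f : α → ℝ≥0∞) : ∀ᵐ x ∂μ, f x ≤ eLpNorm f ∞ μ :=
  eLpNorm_top_le_iff.1 le_rfl

theorem eLpNorm_mono_ennreal {f g : α → ℝ≥0∞} (h : ∀ x, f x ≤ g x) (p : ℝ≥0∞) :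
    eLpNorm f p μ ≤ eLpNorm g p μ :=
  eLpNorm_mono_enorm h

theorem lintegral_mul_le_eLpNorm_mul_eLpNorm {p q : ℝ≥0∞} (hpq : p⁻¹ + q⁻¹ = 1)
    {f g : α → ℝ≥0∞} (hf : Measurable f) (hg : Measurable g) :
    ∫⁻ x, f x * g x ∂μ ≤ eLpNorm f p μ * eLpNorm g q μ := by
  have endpoint : ∀ {f g : α → ℝ≥0∞}, Measurable f →
      ∫⁻ x, f x * g x ∂μ ≤ eLpNorm f 1 μ * eLpNorm g ∞ μ := by
    intro f g hf
    rw [eLpNorm_one_eq_lintegral_enorm, ← lintegral_mul_const _ hf.enorm]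
    refine lintegral_mono_ae ?_
    filter_upwards [ae_le_eLpNorm_top g] with x hx
    exact mul_le_mul_right hx (f x)
  rcases eq_or_ne p ∞ with rfl | hp
  · obtain rfl : q = 1 := by simpa using hpq
    simpa only [mul_comm] using endpoint (g := f) hg
  rcases eq_or_ne q ∞ with rfl | hq
  · obtain rfl : p = 1 := by simpa using hpq
    exact endpoint hf
  have hp0 : p ≠ 0 := by rintro rfl; simp at hpq
  have hq0 : q ≠ 0 := by rintro rfl; simp at hpq
  have : ENNReal.HolderTriple p q 1 := ⟨by rwa [inv_one]⟩
  have hc := ENNReal.HolderTriple.toReal 1 (ENNReal.toReal_pos hp0 hp) (ENNReal.toReal_pos hq0 hq)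
  rw [ENNReal.toReal_one] at hc
  rw [eLpNorm_eq_lintegral_rpow_toReal hp0 hp, eLpNorm_eq_lintegral_rpow_toReal hq0 hq]
  simpa only [one_div, Pi.mul_apply] using
    ENNReal.lintegral_mul_le_Lp_mul_Lq μ hc hf.aemeasurable hg.aemeasurable

theorem measurable_eLpNorm_left [SFinite μ] {f : α → β → ℝ≥0∞}
    (hf : Measurable (Function.uncurry f)) (p : ℝ≥0∞) :
    Measurable fun y => eLpNorm (fun x => f x y) p μ := by
  rcases eq_or_ne p 0 with rfl | h0
  · simp only [eLpNorm_exponent_zero, measurable_const]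
  rcases eq_or_ne p ∞ with rfl | ht
  · refine measurable_of_Iic fun c => ?_
    have hc : (fun y => eLpNorm (fun x => f x y) ∞ μ) ⁻¹' Set.Iic c
        = {y | μ {x | c < f x y} = 0} := by
      ext y
      simp only [Set.mem_preimage, Set.mem_Iic, eLpNorm_top_le_iff, ae_iff, not_le]
      rfl
    rw [hc]
    exact measurable_measure_prodMk_right (measurableSet_lt measurable_const hf)
      (measurableSet_singleton 0)
  · simp only [eLpNorm_eq_lintegral_rpow_toReal h0 ht]
    exact (Measurable.lintegral_prod_left' (hf.pow_const _)).pow_const _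

theorem lintegral_rpow_le_of_forall_lintegral_mul_le [SigmaFinite μ] {p q : ℝ}
    (hpq : p.HolderConjugate q) {h : α → ℝ≥0∞} {A : ℝ≥0∞}
    (hA : ∀ g : α → ℝ≥0∞, Measurable g → ∫⁻ x, h x * g x ∂μ ≤ A * (∫⁻ x, g x ^ q ∂μ) ^ q⁻¹) :
    ∫⁻ x, h x ^ p ∂μ ≤ A ^ p := by
  have hp : 0 < p := hpq.pos
  have hq : 0 < q := hpq.symm.pos
  have split : ∀ a : ℝ≥0∞, a = a ^ p⁻¹ * a ^ q⁻¹ := fun a => by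
    rw [← ENNReal.rpow_add_of_nonneg _ _ (by positivity) (by positivity),
      hpq.inv_add_inv_eq_one, ENNReal.rpow_one]
  rw [lintegral_eq_nnreal]
  refine iSup₂_le fun φ hφ => le_of_not_gt fun hlt => ?_
  rw [← SimpleFunc.lintegral_eq_lintegral] at hlt
  obtain ⟨g, hgφ, hg_top, hg⟩ := SimpleFunc.exists_lt_lintegral_simpleFunc_of_lt_lintegral hlt
  have hgm : Measurable fun x => (g x : ℝ≥0∞) := g.measurable.coe_nnreal_ennreal
  set I := ∫⁻ x, (g x : ℝ≥0∞) ∂μ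
  have hgh : ∀ x, (g x : ℝ≥0∞) ^ p⁻¹ ≤ h x := fun x =>
    (ENNReal.rpow_inv_le_iff hp).2 ((ENNReal.coe_le_coe.2 (hgφ x)).trans (hφ x))
  have hI : I ≤ A * I ^ q⁻¹ := by
    calc I ≤ ∫⁻ x, h x * (g x : ℝ≥0∞) ^ q⁻¹ ∂μ := lintegral_mono fun x => by
          dsimp only
          conv_lhs => rw [split (g x)]
          gcongr
          exact hgh x
      _ ≤ A * I ^ q⁻¹ := by
          simpa only [ENNReal.rpow_inv_rpow hq.ne'] using hA _ (hgm.pow_const q⁻¹)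
  have hI0 : I ≠ 0 := (bot_le.trans_lt hg).ne'
  refine hg.not_ge ((ENNReal.rpow_inv_le_iff hp).1 ?_)
  refine (ENNReal.mul_le_mul_iff_left (c := I ^ q⁻¹) ?_ ?_).1 ((split I).symm.le.trans hI)
  · exact (ENNReal.rpow_pos hI0.bot_lt hg_top.ne).ne'
  · exact ENNReal.rpow_ne_top_of_nonneg (by positivity) hg_top.ne

theorem eLpNorm_top_lintegral_le [SFinite μ] [SFinite ν] {f : α → β → ℝ≥0∞}
    (hf : Measurable (Function.uncurry f)) :
    eLpNorm (fun x => ∫⁻ y, f x y ∂ν) ∞ μ ≤ ∫⁻ y, eLpNorm (fun x => f x y) ∞ μ ∂ν := by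
  have hs : MeasurableSet {z : α × β | f z.1 z.2 ≤ eLpNorm (fun x => f x z.2) ∞ μ} :=
    measurableSet_le hf ((measurable_eLpNorm_left hf ∞).comp measurable_snd)
  have hae : ∀ᵐ x ∂μ, ∀ᵐ y ∂ν, f x y ≤ eLpNorm (fun x => f x y) ∞ μ :=
    (Measure.ae_ae_comm hs).2 (.of_forall fun y => ae_le_eLpNorm_top fun x => f x y)
  exact eLpNorm_top_le_iff.2 (hae.mono fun x hx => lintegral_mono_ae hx)

theorem eLpNorm_lintegral_le [SigmaFinite μ] [SFinite ν] {f : α → β → ℝ≥0∞}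
    (hf : Measurable (Function.uncurry f)) {r : ℝ≥0∞} (hr : 1 ≤ r) :
    eLpNorm (fun x => ∫⁻ y, f x y ∂ν) r μ ≤ ∫⁻ y, eLpNorm (fun x => f x y) r μ ∂ν := by
  rcases eq_or_ne r ∞ with rfl | ht
  · exact eLpNorm_top_lintegral_le hf
  rcases hr.eq_or_lt with rfl | hr1
  · simpa only [eLpNorm_one_eq_lintegral_enorm, enorm_eq_self] using
      (lintegral_lintegral_swap hf.aemeasurable).le
  have hr0 : r ≠ 0 := (zero_lt_one.trans hr1).ne'
  have hp1 : 1 < r.toReal := by simpa using (ENNReal.toReal_lt_toReal ENNReal.one_ne_top ht).2 hr1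
  obtain ⟨q, hpq⟩ : ∃ q, r.toReal.HolderConjugate q := ⟨_, .conjExponent hp1⟩
  rw [eLpNorm_eq_lintegral_rpow_toReal hr0 ht, ENNReal.rpow_inv_le_iff (by linarith)]
  refine lintegral_rpow_le_of_forall_lintegral_mul_le hpq fun g hg => ?_
  calc ∫⁻ x, (∫⁻ y, f x y ∂ν) * g x ∂μ
      = ∫⁻ x, ∫⁻ y, f x y * g x ∂ν ∂μ :=
        lintegral_congr fun x => (lintegral_mul_const _ (hf.comp measurable_prodMk_left)).symm
    _ = ∫⁻ y, ∫⁻ x, f x y * g x ∂μ ∂ν :=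
        lintegral_lintegral_swap (hf.mul (hg.comp measurable_fst)).aemeasurable
    _ ≤ ∫⁻ y, eLpNorm (fun x => f x y) r μ * (∫⁻ x, g x ^ q ∂μ) ^ q⁻¹ ∂ν := by
        refine lintegral_mono fun y => ?_
        rw [eLpNorm_eq_lintegral_rpow_toReal hr0 ht]
        simpa only [one_div, Pi.mul_apply, Function.comp_apply, Function.uncurry_apply_pair] using
          ENNReal.lintegral_mul_le_Lp_mul_Lq μ hpq
            (hf.comp measurable_prodMk_right).aemeasurable hg.aemeasurable
    _ = _ := lintegral_mul_const _ (measurable_eLpNorm_left hf r)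

end MixedNorms

/-- The norm of `L^q(ν; L^p(μ))` of a nonnegative function of `(x, y)`: the `L^p(μ)` norm in the
first variable `x`, then the `L^q(ν)` norm in the second variable `y`. -/
noncomputable def eLpqNorm {α β : Type*} [MeasurableSpace α] [MeasurableSpace β]
    (F : α × β → ℝ≥0∞) (p q : ℝ≥0∞) (μ : Measure α) (ν : Measure β) : ℝ≥0∞ :=
  eLpNorm (fun y => eLpNorm (fun x => F (x, y)) p μ) q ν

section MixedNorm

variable {α β : Type*} [MeasurableSpace α] [MeasurableSpace β] {μ : Measure α} {ν : Measure β}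

theorem eLpqNorm_mono {F G : α × β → ℝ≥0∞} (h : ∀ z, F z ≤ G z) (p q : ℝ≥0∞) :
    eLpqNorm F p q μ ν ≤ eLpqNorm G p q μ ν :=
  eLpNorm_mono_ennreal (fun _ => eLpNorm_mono_ennreal (fun _ => h _) p) q

theorem eLpqNorm_le_const_mul {F G : α × β → ℝ≥0∞} {c : ℝ≥0} (h : ∀ z, F z ≤ c * G z)
    (p q : ℝ≥0∞) : eLpqNorm F p q μ ν ≤ c * eLpqNorm G p q μ ν :=
  eLpNorm_le_nnreal_smul_eLpNorm_of_ae_le_mul'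
    (.of_forall fun _ => eLpNorm_le_nnreal_smul_eLpNorm_of_ae_le_mul' (.of_forall fun _ => h _) p)
    q

theorem eLpqNorm_mul_lt_top {f : α → ℝ} {g : β → ℝ} {p q : ℝ≥0∞} (hf : eLpNorm f p μ < ∞)
    (hg : eLpNorm g q ν < ∞) :
    eLpqNorm (fun z : α × β => ‖f z.1‖ₑ * ‖g z.2‖ₑ) p q μ ν < ∞ := by
  have inner_le : ∀ y, eLpNorm (fun x => ‖f x‖ₑ * ‖g y‖ₑ) p μ
      ≤ (eLpNorm f p μ).toNNReal * ‖g y‖ₑ := fun y => by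
    rw [ENNReal.coe_toNNReal hf.ne, mul_comm]
    exact eLpNorm_le_nnreal_smul_eLpNorm_of_ae_le_mul' (.of_forall fun x => (mul_comm _ _).le) p
  refine (eLpNorm_le_nnreal_smul_eLpNorm_of_ae_le_mul' (.of_forall inner_le) q).trans_lt ?_
  exact ENNReal.mul_lt_top ENNReal.coe_lt_top hg

theorem eLpqNorm_rpow {r : ℝ≥0∞} (h0 : r ≠ 0) (ht : r ≠ ∞) (F : α × β → ℝ≥0∞) (p q : ℝ≥0∞) :
    eLpqNorm (fun z => F z ^ r.toReal) (p / r) (q / r) μ ν = eLpqNorm F p q μ ν ^ r.toReal := by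
  have hr := ENNReal.toReal_pos h0 ht
  have cancel : ∀ t : ℝ≥0∞, t / r * ENNReal.ofReal r.toReal = t := fun t => by
    rw [ENNReal.ofReal_toReal ht, ENNReal.div_mul_cancel h0 ht]
  have inner_eq : ∀ y, eLpNorm (fun x => F (x, y) ^ r.toReal) (p / r) μ
      = eLpNorm (fun x => F (x, y)) p μ ^ r.toReal := fun y => by
    simpa only [enorm_eq_self, cancel] using
      eLpNorm_enorm_rpow (μ := μ) (p := p / r) (fun x => F (x, y)) hr
  simp only [eLpqNorm, inner_eq]
  simpa only [enorm_eq_self, cancel] using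
    eLpNorm_enorm_rpow (μ := ν) (p := q / r) (fun y => eLpNorm (fun x => F (x, y)) p μ) hr

variable [SFinite μ]

theorem eLpqNorm_add_le {F G : α × β → ℝ≥0∞} (hF : Measurable F) (hG : Measurable G)
    {p q : ℝ≥0∞} (hp : 1 ≤ p) (hq : 1 ≤ q) :
    eLpqNorm (fun z => F z + G z) p q μ ν ≤ eLpqNorm F p q μ ν + eLpqNorm G p q μ ν := by
  have inner_le : ∀ y, eLpNorm (fun x => F (x, y) + G (x, y)) p μ
      ≤ eLpNorm (fun x => F (x, y)) p μ + eLpNorm (fun x => G (x, y)) p μ := fun y =>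
    eLpNorm_add_le (f := fun x => F (x, y)) (g := fun x => G (x, y))
      (hF.comp measurable_prodMk_right).aestronglyMeasurable
      (hG.comp measurable_prodMk_right).aestronglyMeasurable hp
  exact (eLpNorm_mono_ennreal inner_le q).trans (eLpNorm_add_le
    (measurable_eLpNorm_left (f := fun x y => F (x, y)) hF p).aestronglyMeasurable
    (measurable_eLpNorm_left (f := fun x y => G (x, y)) hG p).aestronglyMeasurable hq)

theorem eLpqNorm_comp_neg [AddGroup α] [MeasurableNeg α] [μ.IsNegInvariant] [AddGroup β]
    [MeasurableNeg β] [ν.IsNegInvariant] {F : α × β → ℝ≥0∞} (hF : Measurable F) (p q : ℝ≥0∞) :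
    eLpqNorm (fun z => F (-z)) p q μ ν = eLpqNorm F p q μ ν := by
  have inner_eq : ∀ y, eLpNorm (fun x => F (-x, -y)) p μ = eLpNorm (fun x => F (x, -y)) p μ :=
    fun y => eLpNorm_comp_measurePreserving (g := fun x => F (x, -y))
      (hF.comp measurable_prodMk_right).aestronglyMeasurable (Measure.measurePreserving_neg μ)
  simp only [eLpqNorm, Prod.neg_mk, inner_eq]
  exact eLpNorm_comp_measurePreserving (g := fun y => eLpNorm (fun x => F (x, y)) p μ)
    (measurable_eLpNorm_left (f := fun x y => F (x, y)) hF p).aestronglyMeasurable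
    (Measure.measurePreserving_neg ν)

theorem eLpqNorm_self [SFinite ν] {F : α × β → ℝ≥0∞} (hF : Measurable F) (p : ℝ≥0∞) :
    eLpqNorm F p p μ ν = eLpNorm F p (μ.prod ν) := by
  rcases eq_or_ne p 0 with rfl | h0
  · simp [eLpqNorm]
  rcases eq_or_ne p ∞ with rfl | ht
  · refine eq_of_forall_ge_iff fun c => ?_
    have hs : MeasurableSet {z : α × β | F z ≤ c} := measurableSet_le hF measurable_const
    simp only [eLpqNorm, eLpNorm_top_le_iff]
    rw [Measure.ae_prod_iff_ae_ae hs]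
    exact (Measure.ae_ae_comm hs).symm
  · simp only [eLpqNorm, eLpNorm_eq_lintegral_rpow_toReal h0 ht,
      ENNReal.rpow_inv_rpow (ENNReal.toReal_pos h0 ht).ne']
    rw [lintegral_prod_symm' _ (hF.pow_const _)]

end MixedNorm

section Translation

variable {G : Type*} [AddCommGroup G] [MeasurableSpace G] {μ : Measure G}

theorem eLpNorm_mul_comp_add_right [MeasurableNeg G] [μ.IsNegInvariant] {p : ℝ≥0∞} (h0 : p ≠ 0)
    (ht : p ≠ ∞) (f g : G → ℝ≥0∞) (u : G) :
    eLpNorm (fun z => f z * g (z + u)) p μ =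
      ((fun z => f (-z) ^ p.toReal) ⋆ₗ[μ] fun z => g z ^ p.toReal) u ^ p.toReal⁻¹ := by
  rw [eLpNorm_eq_lintegral_rpow_toReal h0 ht, lconvolution_def, ← lintegral_neg_eq_self]
  simp only [ENNReal.mul_rpow_of_nonneg _ _ ENNReal.toReal_nonneg]

theorem eLpNorm_top_mul_comp_add_right_le [MeasurableAdd G] [μ.IsAddRightInvariant]
    (f : G → ℝ≥0∞) {g : G → ℝ≥0∞} (hg : Measurable g) (u : G) :
    eLpNorm (fun z => f z * g (z + u)) ∞ μ ≤ eLpNorm f ∞ μ * eLpNorm g ∞ μ := by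
  have translate : eLpNorm (fun z => g (z + u)) ∞ μ = eLpNorm g ∞ μ :=
    eLpNorm_comp_measurePreserving hg.aestronglyMeasurable (measurePreserving_add_right μ u)
  rw [← translate, eLpNorm_top_le_iff]
  filter_upwards [ae_le_eLpNorm_top f, ae_le_eLpNorm_top fun z => g (z + u)] with z hf hg
  gcongr

end Translation

section Young

variable {G : Type*} [AddCommGroup G] [MeasurableSpace G] [MeasurableAdd₂ G] [MeasurableNeg G]
  {μ : Measure G} [μ.IsAddLeftInvariant]

theorem lintegral_lconvolution [SFinite μ] {f g : G → ℝ≥0∞} (hf : Measurable f)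
    (hg : Measurable g) :
    ∫⁻ x, (f ⋆ₗ[μ] g) x ∂μ = (∫⁻ x, f x ∂μ) * ∫⁻ x, g x ∂μ := by
  simp only [lconvolution_def]
  rw [lintegral_lintegral_swap (by fun_prop), ← lintegral_mul_const _ hf]
  refine lintegral_congr fun y => ?_
  rw [lintegral_const_mul _ (by fun_prop), lintegral_add_left_eq_self g (-y)]

variable [μ.IsNegInvariant]

/-- Hölder's inequality for the factorisation
`f g = (f ^ a g ^ b) ^ (1/c) (f ^ a) ^ (1/a - 1/c) (g ^ b) ^ (1/b - 1/c)`. -/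
theorem lconvolution_le_rpow_mul {a b c : ℝ} (ha : 0 < a) (hb : 0 < b) (hc : 0 < c)
    (hca : c⁻¹ ≤ a⁻¹) (hcb : c⁻¹ ≤ b⁻¹) (habc : a⁻¹ + b⁻¹ = 1 + c⁻¹) {f g : G → ℝ≥0∞}
    (hf : Measurable f) (hg : Measurable g) (x : G) :
    (f ⋆ₗ[μ] g) x ≤ ((fun y => f y ^ a) ⋆ₗ[μ] fun y => g y ^ b) x ^ c⁻¹ *
      ((∫⁻ y, f y ^ a ∂μ) ^ (a⁻¹ - c⁻¹) * (∫⁻ y, g y ^ b ∂μ) ^ (b⁻¹ - c⁻¹)) := by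
  have split : ∀ {r : ℝ}, 0 < r → c⁻¹ ≤ r⁻¹ → ∀ t : ℝ≥0∞,
      (t ^ r) ^ c⁻¹ * (t ^ r) ^ (r⁻¹ - c⁻¹) = t := fun hr hcr t => by
    rw [← ENNReal.rpow_add_of_nonneg _ _ (by positivity) (sub_nonneg.2 hcr), add_sub_cancel,
      ENNReal.rpow_rpow_inv hr.ne']
  have hfm : Measurable fun y => f y ^ a := hf.pow_const a
  have hgm : Measurable fun y => g (-y + x) ^ b := by fun_prop
  have holder := ENNReal.lintegral_prod_norm_pow_le (μ := μ) (Finset.univ : Finset (Fin 3))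
    (f := ![fun y => f y ^ a * g (-y + x) ^ b, fun y => f y ^ a, fun y => g (-y + x) ^ b])
    (p := ![c⁻¹, a⁻¹ - c⁻¹, b⁻¹ - c⁻¹])
    (by simp only [Finset.mem_univ, forall_const, Fin.forall_fin_succ]
        exact ⟨(hfm.mul hgm).aemeasurable, hfm.aemeasurable, hgm.aemeasurable,
          fun i => i.elim0⟩)
    (by simp only [Fin.sum_univ_three, Matrix.cons_val]; linarith)
    (by simp only [Finset.mem_univ, forall_const, Fin.forall_fin_succ]
        exact ⟨by simpa using hc.le, sub_nonneg.2 hca, sub_nonneg.2 hcb, fun i => i.elim0⟩)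
  simp only [Fin.prod_univ_three, Matrix.cons_val] at holder
  have hinv : ∫⁻ y, g (-y + x) ^ b ∂μ = ∫⁻ y, g y ^ b ∂μ := by
    simpa only [neg_add_eq_sub] using lintegral_sub_left_eq_self (fun y => g y ^ b) x
  rw [hinv, mul_assoc] at holder
  refine le_trans (lintegral_mono fun y => le_of_eq ?_) holder
  rw [ENNReal.mul_rpow_of_nonneg _ _ (inv_nonneg.2 hc.le)]
  nth_rewrite 1 [← split ha hca (f y), ← split hb hcb (g (-y + x))]
  ring

theorem lintegral_lconvolution_rpow_le [SFinite μ] {a b c : ℝ} (ha : 0 < a) (hb : 0 < b)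
    (hc : 0 < c) (hca : c⁻¹ ≤ a⁻¹) (hcb : c⁻¹ ≤ b⁻¹) (habc : a⁻¹ + b⁻¹ = 1 + c⁻¹)
    {f g : G → ℝ≥0∞} (hf : Measurable f) (hg : Measurable g) :
    (∫⁻ x, (f ⋆ₗ[μ] g) x ^ c ∂μ) ^ c⁻¹ ≤
      (∫⁻ x, f x ^ a ∂μ) ^ a⁻¹ * (∫⁻ x, g x ^ b ∂μ) ^ b⁻¹ := by
  set A := ∫⁻ x, f x ^ a ∂μ
  set B := ∫⁻ x, g x ^ b ∂μ
  have hle : ∫⁻ x, (f ⋆ₗ[μ] g) x ^ c ∂μ ≤ A * B * (A ^ (a⁻¹ - c⁻¹) * B ^ (b⁻¹ - c⁻¹)) ^ c := by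
    rw [← lintegral_lconvolution (hf.pow_const a) (hg.pow_const b), ← lintegral_mul_const _
      (measurable_lconvolution _ (hf.pow_const a) (hg.pow_const b))]
    refine lintegral_mono fun x => ?_
    refine (ENNReal.rpow_le_rpow
      (lconvolution_le_rpow_mul ha hb hc hca hcb habc hf hg x) hc.le).trans_eq ?_
    rw [ENNReal.mul_rpow_of_nonneg _ _ hc.le, ENNReal.rpow_inv_rpow hc.ne']
  calc (∫⁻ x, (f ⋆ₗ[μ] g) x ^ c ∂μ) ^ c⁻¹
      ≤ (A * B * (A ^ (a⁻¹ - c⁻¹) * B ^ (b⁻¹ - c⁻¹)) ^ c) ^ c⁻¹ := by gcongr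
    _ = (A ^ c⁻¹ * A ^ (a⁻¹ - c⁻¹)) * (B ^ c⁻¹ * B ^ (b⁻¹ - c⁻¹)) := by
        rw [ENNReal.mul_rpow_of_nonneg _ _ (by positivity), ENNReal.rpow_rpow_inv hc.ne',
          ENNReal.mul_rpow_of_nonneg _ _ (by positivity)]
        ring
    _ = A ^ a⁻¹ * B ^ b⁻¹ := by
        rw [← ENNReal.rpow_add_of_nonneg _ _ (by positivity) (sub_nonneg.2 hca), add_sub_cancel,
          ← ENNReal.rpow_add_of_nonneg _ _ (by positivity) (sub_nonneg.2 hcb), add_sub_cancel]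

theorem eLpNorm_lconvolution_le [SFinite μ] {p q r : ℝ≥0∞} (hp : 1 ≤ p) (hq : 1 ≤ q)
    (hpqr : p⁻¹ + q⁻¹ = 1 + r⁻¹) {f g : G → ℝ≥0∞} (hf : Measurable f) (hg : Measurable g) :
    eLpNorm (f ⋆ₗ[μ] g) r μ ≤ eLpNorm f p μ * eLpNorm g q μ := by
  have hp0 : p ≠ 0 := (zero_lt_one.trans_le hp).ne'
  have hq0 : q ≠ 0 := (zero_lt_one.trans_le hq).ne'
  rcases eq_or_ne r ∞ with rfl | hr
  · refine eLpNorm_top_le_iff.2 (.of_forall fun x => ?_)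
    rw [lconvolution_def]
    refine (lintegral_mul_le_eLpNorm_mul_eLpNorm (by simpa using hpqr) hf
      (by fun_prop : Measurable fun y => g (-y + x))).trans_eq ?_
    congr 1
    simpa only [neg_add_eq_sub, Function.comp_def] using eLpNorm_comp_measurePreserving (p := q)
      hg.aestronglyMeasurable (Measure.measurePreserving_sub_left μ x)
  have hp_inv : p⁻¹ ≤ 1 := ENNReal.inv_le_one.2 hp
  have hq_inv : q⁻¹ ≤ 1 := ENNReal.inv_le_one.2 hq
  have hrp : r⁻¹ ≤ p⁻¹ := by
    refine (ENNReal.add_le_add_iff_left ENNReal.one_ne_top).1 (hpqr.ge.trans ?_)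
    rw [add_comm]; gcongr
  have hrq : r⁻¹ ≤ q⁻¹ := by
    refine (ENNReal.add_le_add_iff_left ENNReal.one_ne_top).1 (hpqr.ge.trans ?_)
    gcongr
  have hr0 : r ≠ 0 := by rintro rfl; simp [hp0] at hrp
  have hpt : p ≠ ∞ := by rintro rfl; simp [hr] at hrp
  have hqt : q ≠ ∞ := by rintro rfl; simp [hr] at hrq
  have hsum := congrArg ENNReal.toReal hpqr
  rw [ENNReal.toReal_add (by simpa using hp0) (by simpa using hq0),
    ENNReal.toReal_add (by simp) (by simpa using hr0)] at hsum
  have hrp' := ENNReal.toReal_mono (by simpa using hp0) hrp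
  have hrq' := ENNReal.toReal_mono (by simpa using hq0) hrq
  simp only [ENNReal.toReal_inv, ENNReal.toReal_one] at hsum hrp' hrq'
  rw [eLpNorm_eq_lintegral_rpow_toReal hr0 hr, eLpNorm_eq_lintegral_rpow_toReal hp0 hpt,
    eLpNorm_eq_lintegral_rpow_toReal hq0 hqt]
  exact lintegral_lconvolution_rpow_le (ENNReal.toReal_pos hp0 hpt) (ENNReal.toReal_pos hq0 hqt)
    (ENNReal.toReal_pos hr0 hr) hrp' hrq' hsum hf hg

variable {H : Type*} [AddCommGroup H] [MeasurableSpace H] [MeasurableAdd₂ H] [MeasurableNeg H]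
  {ν : Measure H} [SFinite ν] [SigmaFinite μ]

theorem eLpNorm_lconvolution_prod_le {p₁ p₂ p : ℝ≥0∞} (hp₁ : 1 ≤ p₁) (hp₂ : 1 ≤ p₂) (hp : 1 ≤ p)
    (hpp : p₁⁻¹ + p₂⁻¹ = 1 + p⁻¹) {A B : G × H → ℝ≥0∞} (hA : Measurable A) (hB : Measurable B)
    (ξ : H) :
    eLpNorm (fun x => (A ⋆ₗ[μ.prod ν] B) (x, ξ)) p μ ≤
      ((fun η => eLpNorm (fun x => A (x, η)) p₁ μ) ⋆ₗ[ν]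
        fun η => eLpNorm (fun x => B (x, η)) p₂ μ) ξ := by
  have hconv : ∀ x, (A ⋆ₗ[μ.prod ν] B) (x, ξ)
      = ∫⁻ η, ((fun y => A (y, η)) ⋆ₗ[μ] fun y => B (y, -η + ξ)) x ∂ν := fun x =>
    lintegral_prod_symm' (fun z : G × H => A z * B (-z.1 + x, -z.2 + ξ)) (by fun_prop)
  simp only [hconv]
  refine (eLpNorm_lintegral_le (f := fun x η =>
    ((fun y => A (y, η)) ⋆ₗ[μ] fun y => B (y, -η + ξ)) x) ?_ hp).trans
      (lintegral_mono fun η => ?_)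
  · simp only [lconvolution_def, Function.uncurry_def]
    fun_prop
  · exact eLpNorm_lconvolution_le hp₁ hp₂ hpp (by fun_prop) (by fun_prop)

variable [ν.IsAddLeftInvariant] [ν.IsNegInvariant]

theorem eLpqNorm_lconvolution_le {p₁ p₂ p q₁ q₂ q : ℝ≥0∞} (hp₁ : 1 ≤ p₁) (hp₂ : 1 ≤ p₂)
    (hp : 1 ≤ p) (hq₁ : 1 ≤ q₁) (hq₂ : 1 ≤ q₂) (hpp : p₁⁻¹ + p₂⁻¹ = 1 + p⁻¹)
    (hqq : q₁⁻¹ + q₂⁻¹ = 1 + q⁻¹) {A B : G × H → ℝ≥0∞} (hA : Measurable A) (hB : Measurable B) :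
    eLpqNorm (A ⋆ₗ[μ.prod ν] B) p q μ ν ≤ eLpqNorm A p₁ q₁ μ ν * eLpqNorm B p₂ q₂ μ ν :=
  (eLpNorm_mono_ennreal (eLpNorm_lconvolution_prod_le hp₁ hp₂ hp hpp hA hB) q).trans <|
    eLpNorm_lconvolution_le hq₁ hq₂ hqq
      (measurable_eLpNorm_left (f := fun x η => A (x, η)) hA p₁)
      (measurable_eLpNorm_left (f := fun x η => B (x, η)) hB p₂)

instance : MeasurableAdd (G × H) where
  measurable_const_add c :=
    (measurable_fst.const_add c.1).prodMk (measurable_snd.const_add c.2)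
  measurable_add_const c :=
    (measurable_fst.add_const c.1).prodMk (measurable_snd.add_const c.2)

instance : MeasurableNeg (G × H) :=
  ⟨measurable_fst.neg.prodMk measurable_snd.neg⟩

instance [SigmaFinite ν] : (μ.prod ν).IsNegInvariant where
  neg_eq_self :=
    ((Measure.measurePreserving_neg μ).prod (Measure.measurePreserving_neg ν)).map_eq

theorem inv_div_add_inv_div_eq {p p₁ p₂ r : ℝ≥0∞} (h0 : p ≠ 0) (ht : p ≠ ∞)
    (h : p₁⁻¹ + p₂⁻¹ = p⁻¹ + r⁻¹) : (p₁ / p)⁻¹ + (p₂ / p)⁻¹ = 1 + (r / p)⁻¹ := by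
  have inv_div : ∀ t : ℝ≥0∞, (t / p)⁻¹ = p * t⁻¹ := fun t => by
    rw [ENNReal.inv_div (Or.inl ht) (Or.inl h0), div_eq_mul_inv]
  rw [inv_div, inv_div, inv_div, ← mul_add, h, mul_add, ENNReal.mul_inv_cancel h0 ht]

/-- This is Young's inequality for the `p`-th powers of `A` and `B`, so all exponents are divided by
`p`. -/
theorem eLpqNorm_eLpNorm_mul_comp_add_right_le [SigmaFinite ν] {p p₁ p₂ q₁ q₂ r t : ℝ≥0∞}
    (h0 : p ≠ 0) (hp₁ : p ≤ p₁) (hp₂ : p ≤ p₂) (hq₁ : p ≤ q₁) (hq₂ : p ≤ q₂) (hr : p ≤ r)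
    (hpp : p₁⁻¹ + p₂⁻¹ = p⁻¹ + r⁻¹) (hqq : q₁⁻¹ + q₂⁻¹ = p⁻¹ + t⁻¹) {A B : G × H → ℝ≥0∞}
    (hA : Measurable A) (hB : Measurable B) :
    eLpqNorm (fun u => eLpNorm (fun z => A z * B (z + u)) p (μ.prod ν)) r t μ ν ≤
      eLpqNorm A p₁ q₁ μ ν * eLpqNorm B p₂ q₂ μ ν := by
  rcases eq_or_ne p ∞ with rfl | ht
  · obtain rfl := top_le_iff.1 hp₁
    obtain rfl := top_le_iff.1 hp₂
    obtain rfl := top_le_iff.1 hq₁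
    obtain rfl := top_le_iff.1 hq₂
    obtain rfl := top_le_iff.1 hr
    obtain rfl : t = ∞ := by simpa using hqq.symm
    rw [eLpqNorm_self hA, eLpqNorm_self hB]
    exact eLpNorm_top_le_iff.2 <| .of_forall fun y => eLpNorm_top_le_iff.2 <|
      .of_forall fun x => eLpNorm_top_mul_comp_add_right_le A hB (x, y)
  have one_le_div : ∀ {s : ℝ≥0∞}, p ≤ s → 1 ≤ s / p := fun h => by
    rwa [ENNReal.le_div_iff_mul_le (Or.inl h0) (Or.inl ht), one_mul]
  have hpos := ENNReal.toReal_pos h0 ht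
  have hAp : Measurable fun z => A z ^ p.toReal := hA.pow_const _
  refine (ENNReal.rpow_le_rpow_iff hpos).1 ?_
  rw [← eLpqNorm_rpow h0 ht, ENNReal.mul_rpow_of_nonneg _ _ hpos.le, ← eLpqNorm_rpow h0 ht A,
    ← eLpqNorm_rpow h0 ht B, ← eLpqNorm_comp_neg hAp]
  simp only [eLpNorm_mul_comp_add_right h0 ht, ENNReal.rpow_inv_rpow hpos.ne']
  exact eLpqNorm_lconvolution_le (one_le_div hp₁) (one_le_div hp₂) (one_le_div hr)
    (one_le_div hq₁) (one_le_div hq₂) (inv_div_add_inv_div_eq h0 ht hpp)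
    (inv_div_add_inv_div_eq h0 ht hqq) (hAp.comp measurable_neg) (hB.pow_const _)

end Young

section Fubini

open Filter Topology
open scoped BoundedContinuousFunction

theorem exists_comp_eq_of_norm_le {A B : Type*} [AddCommGroup A] [Module ℂ A]
    [NormedAddCommGroup B] [NormedSpace ℂ B] (T : A →ₗ[ℂ] B) (F : A →ₗ[ℂ] ℂ) {C : ℝ}
    (h : ∀ a, ‖F a‖ ≤ C * ‖T a‖) : ∃ L : B →L[ℂ] ℂ, ∀ a, L (T a) = F a := by
  have hker : LinearMap.ker T ≤ LinearMap.ker F := fun a ha => by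
    simpa [LinearMap.mem_ker.1 ha] using h a
  let f : LinearMap.range T →ₗ[ℂ] ℂ :=
    (LinearMap.ker T).liftQ F hker ∘ₗ T.quotKerEquivRange.symm.toLinearMap
  have hf : ∀ a, f ⟨T a, a, rfl⟩ = F a := fun a => by
    change (LinearMap.ker T).liftQ F hker (T.quotKerEquivRange.symm _) = F a
    rw [LinearMap.quotKerEquivRange_symm_apply_image T a ⟨a, rfl⟩]
    rfl
  obtain ⟨L, hL, -⟩ := exists_extension_norm_eq _ (f.mkContinuous C (by
    rintro ⟨_, a, rfl⟩
    rw [hf]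
    exact h a))
  exact ⟨L, fun a => (hL ⟨T a, a, rfl⟩).trans (hf a)⟩

variable {Y V : Type*} [NormedAddCommGroup Y] [NormedSpace ℝ Y]
  [NormedAddCommGroup V] [NormedSpace ℝ V]

variable (V) in
/-- The Banach space of bounded continuous functions on `V` with values in the `n`-linear forms,
the target of the weighted jets below. It is a type synonym because instance search does not
identify the norm topology of the bounded continuous functions with their uniform topology. -/
def JetSpace (n : ℕ) : Type _ := V →ᵇ (V [×n]→L[ℝ] ℂ)

noncomputable instance (n : ℕ) : NormedAddCommGroup (JetSpace V n) :=
  inferInstanceAs (NormedAddCommGroup (V →ᵇ (V [×n]→L[ℝ] ℂ)))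

noncomputable instance (n : ℕ) : NormedSpace ℂ (JetSpace V n) :=
  inferInstanceAs (NormedSpace ℂ (V →ᵇ (V [×n]→L[ℝ] ℂ)))

instance (n : ℕ) : CompleteSpace (JetSpace V n) :=
  inferInstanceAs (CompleteSpace (V →ᵇ (V [×n]→L[ℝ] ℂ)))

/-- The evaluation `f ↦ f(t)(w₁, …, wₙ)`, through which identities in `JetSpace V n` are
checked. -/
noncomputable def jetEval {n : ℕ} (t : V) (w : Fin n → V) : JetSpace V n →L[ℝ] ℂ :=
  (ContinuousMultilinearMap.apply ℝ (fun _ => V) ℂ w).comp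
    (BoundedContinuousFunction.evalCLM ℝ t : (V →ᵇ (V [×n]→L[ℝ] ℂ)) →L[ℝ] (V [×n]→L[ℝ] ℂ))

theorem JetSpace.ext {n : ℕ} {f g : JetSpace V n} (h : ∀ t w, jetEval t w f = jetEval t w g) :
    f = g :=
  BoundedContinuousFunction.ext fun t => ContinuousMultilinearMap.ext (h t)

/-- The weighted jet `t ↦ ‖t‖ ^ k • Dⁿφ(t)` of a Schwartz function. -/
noncomputable def jetFun (k n : ℕ) (φ : 𝓢(V, ℂ)) : V →ᵇ (V [×n]→L[ℝ] ℂ) :=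
  BoundedContinuousFunction.ofNormedAddCommGroup
    (fun t => ‖t‖ ^ k • iteratedFDeriv ℝ n φ t)
    ((continuous_norm.pow k).smul ((φ.smooth n).continuous_iteratedFDeriv le_rfl))
    (SchwartzMap.seminorm ℂ k n φ)
    fun t => by
      rw [norm_smul, norm_pow, norm_norm]
      exact SchwartzMap.le_seminorm ℂ k n φ t

theorem norm_jetFun (k n : ℕ) (φ : 𝓢(V, ℂ)) :
    ‖jetFun k n φ‖ = SchwartzMap.seminorm ℂ k n φ := by
  refine le_antisymm (BoundedContinuousFunction.norm_ofNormedAddCommGroup_le _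
    (apply_nonneg _ _) _) (SchwartzMap.seminorm_le_bound ℂ k n φ (norm_nonneg (jetFun k n φ))
      fun t => ?_)
  simpa only [jetFun, BoundedContinuousFunction.coe_ofNormedAddCommGroup, norm_smul, norm_pow,
    norm_norm] using (jetFun k n φ).norm_coe_le_norm t

theorem jetEval_jetFun {k n : ℕ} (φ : 𝓢(V, ℂ)) (t : V) (w : Fin n → V) :
    jetEval t w (jetFun k n φ) = ‖t‖ ^ k • (∂^{w} φ : 𝓢(V, ℂ)) t := by
  rw [iteratedLineDerivOp_eq_iteratedFDeriv]
  rfl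

/-- The continuous linear map `φ ↦ (t ↦ ‖t‖ ^ k • Dⁿφ(t))` into a Banach space; the norm of the
image is the Schwartz seminorm of index `(k, n)`. -/
noncomputable def weightedJet (k n : ℕ) : 𝓢(V, ℂ) →L[ℂ] JetSpace V n :=
  mkCLMtoNormedSpace (σ := RingHom.id ℂ) (jetFun k n)
    (fun φ ψ => JetSpace.ext fun t w => by
      refine Eq.trans ?_ (map_add (jetEval t w) _ _).symm
      simp only [jetEval_jetFun, iteratedLineDerivOp_add, _root_.add_apply, smul_add])
    (fun c φ => JetSpace.ext fun t w => by
      refine Eq.trans ?_ (congrArg (c • ·) (jetEval_jetFun φ t w)).symm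
      simp only [jetEval_jetFun, iteratedLineDerivOp_smul, _root_.smul_apply]
      exact smul_comm _ _ _)
    ⟨{(k, n)}, 1, zero_le_one, fun φ => by
      rw [one_mul, Finset.sup_singleton]
      exact (norm_jetFun k n φ).le⟩

theorem norm_weightedJet (k n : ℕ) (φ : 𝓢(V, ℂ)) :
    ‖weightedJet k n φ‖ = SchwartzMap.seminorm ℂ k n φ :=
  norm_jetFun k n φ

theorem jetEval_weightedJet {k n : ℕ} (φ : 𝓢(V, ℂ)) (t : V) (w : Fin n → V) :
    jetEval t w (weightedJet k n φ) = ‖t‖ ^ k • (∂^{w} φ : 𝓢(V, ℂ)) t :=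
  jetEval_jetFun φ t w

theorem exists_factor_weightedJet (F : 𝓢'(V, ℂ)) : ∃ (s : Finset (ℕ × ℕ))
    (L : ((i : s) → JetSpace V i.1.2) →L[ℂ] ℂ),
    ∀ φ, F φ = L fun i => weightedJet i.1.1 i.1.2 φ := by
  obtain ⟨s, C, -, h⟩ := Seminorm.bound_of_continuous (schwartz_withSeminorms ℂ V ℂ)
    ((normSeminorm ℂ ℂ).comp F.toLinearMap) (continuous_norm.comp F.continuous)
  let T : 𝓢(V, ℂ) →L[ℂ] (i : s) → JetSpace V i.1.2 :=
    ContinuousLinearMap.pi fun i => weightedJet i.1.1 i.1.2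
  have hT : ∀ φ, s.sup (schwartzSeminormFamily ℂ V ℂ) φ ≤ ‖T φ‖ := fun φ =>
    Seminorm.finset_sup_apply_le (norm_nonneg _) fun i hi =>
      (norm_weightedJet i.1 i.2 φ).ge.trans (norm_le_pi_norm (T φ) ⟨i, hi⟩)
  obtain ⟨L, hL⟩ := exists_comp_eq_of_norm_le T.toLinearMap F.toLinearMap (C := C) fun φ =>
    (h φ).trans (mul_le_mul_of_nonneg_left (hT φ) C.2)
  exact ⟨s, L, fun φ => (hL φ).symm⟩

theorem tendsto_taylorRem (Φ : 𝓢(V, ℂ)) : Tendsto (taylorRem Φ) (𝓝 0) (𝓝 0) := by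
  rw [(schwartz_withSeminorms ℂ V ℂ).tendsto_nhds]
  rintro ⟨k, n⟩ ε hε
  obtain ⟨C, -, h⟩ := taylorRem_seminorm_le Φ k n
  have hlim : Tendsto (fun m : V => C * ‖m‖ ^ 2) (𝓝 0) (𝓝 0) := by
    have hcont : Continuous fun m : V => C * ‖m‖ ^ 2 := by fun_prop
    simpa using hcont.tendsto 0
  filter_upwards [hlim.eventually_lt_const hε, Metric.closedBall_mem_nhds (0 : V) one_pos]
    with m hm hm1
  rw [sub_zero]
  exact (h m (by simpa using hm1)).trans_lt hm

theorem lineDerivOp_sliceCLM (Θ : 𝓢(Y × V, ℂ)) (y : Y) (a : V) :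
    (∂_{a} (sliceCLM y Θ) : 𝓢(V, ℂ)) = sliceCLM y (∂_{((0, a) : Y × V)} Θ : 𝓢(Y × V, ℂ)) := by
  ext t
  have h : HasFDerivAt (sliceCLM y Θ)
      ((fderiv ℝ Θ (y, t)).comp (ContinuousLinearMap.inr ℝ Y V)) t :=
    (Θ.hasFDerivAt (y, t)).comp t (hasFDerivAt_prodMk_right y t)
  rw [sliceCLM_apply, lineDerivOp_apply_eq_fderiv, lineDerivOp_apply_eq_fderiv, h.fderiv,
    ContinuousLinearMap.comp_apply, ContinuousLinearMap.inr_apply]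

variable [FiniteDimensional ℝ Y]

theorem sliceCLM_eq_taylor (Θ : 𝓢(Y × V, ℂ)) (x w : Y) :
    sliceCLM w Θ = sliceCLM x (taylorRem Θ (w - x, 0)) + sliceCLM x Θ
      + ∑ i, ((Module.finBasis ℝ Y).repr (w - x) i : ℂ) •
        sliceCLM x (∂_{((Module.finBasis ℝ Y i, 0) : Y × V)} Θ : 𝓢(Y × V, ℂ)) := by
  have htranslate : sliceCLM w Θ
      = sliceCLM x (compSubConstCLM ℂ (-((w - x, 0) : Y × V)) Θ) := by
    ext t; simp
  rw [htranslate]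
  simp only [taylorRem, map_sub, lineDerivOp_inl_eq_sum Θ (w - x), map_sum, map_smul]
  abel

theorem continuous_sliceCLM (Θ : 𝓢(Y × V, ℂ)) : Continuous fun y => sliceCLM y Θ := by
  refine continuous_iff_continuousAt.2 fun x => ?_
  have hrem : Tendsto (fun w : Y => sliceCLM x (taylorRem Θ (w - x, 0))) (𝓝 x) (𝓝 0) := by
    have hsub : Tendsto (fun w : Y => ((w - x, 0) : Y × V)) (𝓝 x) (𝓝 0) := by
      have hcont : Continuous fun w : Y => ((w - x, 0) : Y × V) := by fun_prop
      simpa [Prod.zero_eq_mk] using hcont.tendsto x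
    simpa [Function.comp_def] using
      ((sliceCLM x).continuous.tendsto 0).comp ((tendsto_taylorRem Θ).comp hsub)
  have hderiv : ∀ i, Tendsto (fun w : Y => ((Module.finBasis ℝ Y).repr (w - x) i : ℂ) •
      sliceCLM x (∂_{((Module.finBasis ℝ Y i, 0) : Y × V)} Θ : 𝓢(Y × V, ℂ))) (𝓝 x) (𝓝 0) := by
    intro i
    have hcoord : Continuous fun w : Y => ((Module.finBasis ℝ Y).repr (w - x) i : ℂ) :=
      Complex.continuous_ofReal.comp
        (((Module.finBasis ℝ Y).coord i).continuous_of_finiteDimensional.comp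
          (continuous_id.sub continuous_const))
    simpa using (hcoord.tendsto x).smul_const
      (sliceCLM x (∂_{((Module.finBasis ℝ Y i, 0) : Y × V)} Θ : 𝓢(Y × V, ℂ)))
  have hsum := (hrem.add_const (sliceCLM x Θ)).add
    (tendsto_finsetSum Finset.univ fun i _ => hderiv i)
  simpa only [ContinuousAt, ← sliceCLM_eq_taylor, zero_add, Finset.sum_const_zero,
    add_zero] using hsum

theorem lineDerivOp_contractSnd (h : 𝓢'(V, ℂ)) (Ψ : 𝓢(Y × V, ℂ)) (a : Y) :
    (∂_{a} (contractSnd h Ψ) : 𝓢(Y, ℂ))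
      = contractSnd h (∂_{((a, 0) : Y × V)} Ψ : 𝓢(Y × V, ℂ)) := by
  ext x
  let L : 𝓢(V, ℂ) →L[ℂ] 𝓢(PUnit.{1}, ℂ) := constPoint.comp ⟨h.toLinearMap, h.continuous⟩
  have hfderiv : HasFDerivAt (idTensorFun L Ψ ∘ fun x' => (x', PUnit.unit)) _ x :=
    (hasFDerivAt_idTensorFun L Ψ (x, PUnit.unit)).comp x (hasFDerivAt_prodMk_left x PUnit.unit)
  have hcoord : ∀ i, coordSnd i ((a, 0) : Y × PUnit.{1}) = 0 := fun i =>
    map_zero ((Module.finBasis ℝ PUnit.{1}).coord i)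
  rw [lineDerivOp_apply_eq_fderiv]
  refine (DFunLike.congr_fun hfderiv.fderiv a).trans ?_
  rw [lineDerivOp_inl_eq_sum, map_sum]
  simp only [map_smul, _root_.sum_apply, _root_.smul_apply, ContinuousLinearMap.comp_apply,
    ContinuousLinearMap.inl_apply, _root_.add_apply, ContinuousLinearMap.smulRight_apply,
    hcoord, zero_smul, Finset.sum_const_zero, add_zero]
  rfl

variable [MeasurableSpace Y] [BorelSpace Y] {μ : Measure Y} [μ.HasTemperateGrowth]

theorem integrable_weightedJet_sliceCLM (k n : ℕ) (Θ : 𝓢(Y × V, ℂ)) :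
    Integrable (fun y => weightedJet k n (sliceCLM y Θ)) μ := by
  have hmeas : AEStronglyMeasurable (fun y => weightedJet k n (sliceCLM y Θ)) μ :=
    ((weightedJet k n).continuous.comp (continuous_sliceCLM Θ)).aestronglyMeasurable
  have hdecay : ∀ (j : ℕ) (y : Y), ‖y‖ ^ j * ‖weightedJet k n (sliceCLM y Θ)‖
      ≤ SchwartzMap.seminorm ℂ (j + k) n Θ := fun j y => by
    rw [norm_weightedJet]
    exact sliceCLM_seminorm_le y Θ j k n
  rw [← integrable_norm_iff hmeas]
  simpa using integrable_of_le_of_pow_mul_le (μ := μ) (k := 0)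
    (fun y => by simpa using hdecay 0 y) (hdecay _) hmeas

variable [FiniteDimensional ℝ V]

theorem lineDerivOp_eq_integral {Θ : 𝓢(Y × V, ℂ)} {φ : 𝓢(V, ℂ)}
    (h : ∀ t, φ t = ∫ y, Θ (y, t) ∂μ) (a t : V) :
    (∂_{a} φ : 𝓢(V, ℂ)) t = ∫ y, (∂_{((0, a) : Y × V)} Θ : 𝓢(Y × V, ℂ)) (y, t) ∂μ := by
  let e := ContinuousLinearEquiv.prodComm ℝ V Y
  have hφ : φ = contractSnd μ.toTemperedDistribution (compCLMOfContinuousLinearEquiv ℂ e Θ) := by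
    ext t
    simp [h, e]
  rw [hφ, lineDerivOp_contractSnd, contractSnd_apply]
  refine (Measure.toTemperedDistribution_apply μ _).trans ?_
  refine integral_congr_ae (.of_forall fun y => ?_)
  simp only [sliceCLM_apply]
  rw [lineDerivOp_compCLMOfContinuousLinearEquiv]
  rfl

theorem iteratedLineDerivOp_eq_integral {n : ℕ} {Θ : 𝓢(Y × V, ℂ)} {φ : 𝓢(V, ℂ)}
    (h : ∀ t, φ t = ∫ y, Θ (y, t) ∂μ) (w : Fin n → V) (t : V) :
    (∂^{w} φ : 𝓢(V, ℂ)) t = ∫ y, (∂^{w} (sliceCLM y Θ) : 𝓢(V, ℂ)) t ∂μ := by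
  induction n generalizing Θ φ t with
  | zero => simpa using h t
  | succ n ih =>
    rw [iteratedLineDerivOp_succ_right, ih (lineDerivOp_eq_integral h _)]
    simp only [iteratedLineDerivOp_succ_right w, lineDerivOp_sliceCLM]

theorem weightedJet_eq_integral (k n : ℕ) {Θ : 𝓢(Y × V, ℂ)} {φ : 𝓢(V, ℂ)}
    (h : ∀ t, φ t = ∫ y, Θ (y, t) ∂μ) :
    weightedJet k n φ = ∫ y, weightedJet k n (sliceCLM y Θ) ∂μ := by
  refine JetSpace.ext fun t w => ?_
  rw [← (jetEval t w).integral_comp_comm (integrable_weightedJet_sliceCLM k n Θ)]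
  simp only [jetEval_weightedJet]
  rw [integral_smul, iteratedLineDerivOp_eq_integral h]

/-- A tempered distribution factors through finitely many weighted jets, that is, through a Banach
space in which the slices of `Θ` have a Bochner integral. -/
theorem distrib_integral_eq (F : 𝓢'(V, ℂ)) {Θ : 𝓢(Y × V, ℂ)} {φ : 𝓢(V, ℂ)}
    (h : ∀ t, φ t = ∫ y, Θ (y, t) ∂μ) : F φ = ∫ y, F (sliceCLM y Θ) ∂μ := by
  obtain ⟨s, L, hL⟩ := exists_factor_weightedJet F
  have hint := fun i : s => integrable_weightedJet_sliceCLM (μ := μ) i.1.1 i.1.2 Θ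
  simp only [hL]
  rw [L.integral_comp_comm (Integrable.of_eval hint)]
  congr 1
  ext1 i
  rw [eval_integral hint]
  exact weightedJet_eq_integral _ _ h

end Fubini

section TensorSchwartz

variable {E F : Type*} [NormedAddCommGroup E] [NormedSpace ℝ E] [FiniteDimensional ℝ E]
  [NormedAddCommGroup F] [NormedSpace ℝ F] [FiniteDimensional ℝ F]

/-- The tensor product `(x, y) ↦ A x * B y` of two Schwartz functions. The definition extends
`A` to `E × PUnit` and lets `idTensorCLM` replace the trivial second variable by `B`. -/
noncomputable def tensorSchwartz (A : 𝓢(E, ℂ)) (B : 𝓢(F, ℂ)) : 𝓢(E × F, ℂ) :=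
  idTensorCLM (((BoundedContinuousFunction.evalCLM ℂ PUnit.unit).comp
      (toBoundedContinuousFunctionCLM ℂ PUnit.{1} ℂ)).smulRight B)
    (compCLMOfContinuousLinearEquiv ℂ (ContinuousLinearEquiv.prodUnique ℝ E PUnit.{1}) A)

theorem tensorSchwartz_apply (A : 𝓢(E, ℂ)) (B : 𝓢(F, ℂ)) (x : E) (y : F) :
    tensorSchwartz A B (x, y) = A x * B y :=
  rfl

end TensorSchwartz

section Character

variable {V : Type*} [NormedAddCommGroup V] [InnerProductSpace ℝ V]

theorem character_add_left (ξ η t : V) : character (ξ + η) t = character ξ t * character η t := by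
  rw [character, character, character, ← Complex.exp_add, inner_add_left]
  push_cast
  ring_nf

theorem character_comm (ξ t : V) : character ξ t = character t ξ := by
  rw [character, character, real_inner_comm]

theorem character_add_right (ξ t u : V) :
    character ξ (t + u) = character ξ t * character ξ u := by
  simp only [character_comm ξ, character_add_left]

@[simp]
theorem norm_character (ξ t : V) : ‖character ξ t‖ = 1 := by
  rw [character, show (2 * Real.pi * Complex.I * (inner ℝ ξ t : ℝ) : ℂ)
    = ((2 * Real.pi * inner ℝ ξ t : ℝ) : ℂ) * Complex.I by push_cast; ring,
    Complex.norm_exp_ofReal_mul_I]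

@[simp]
theorem conj_character (ξ t : V) : starRingEnd ℂ (character ξ t) = character (-ξ) t := by
  rw [character, character, ← Complex.exp_conj]
  simp [inner_neg_left, Complex.conj_ofReal, map_ofNat]

theorem character_neg_right (ξ t : V) : character ξ (-t) = character (-ξ) t := by
  rw [character, character, inner_neg_left, inner_neg_right]

theorem hasTemperateGrowth_character_comp {D : Type*} [NormedAddCommGroup D] [NormedSpace ℝ D]
    {a b : D → V} (ha : a.HasTemperateGrowth) (hb : b.HasTemperateGrowth) :
    (fun z => character (a z) (b z)).HasTemperateGrowth := by
  have key : (fun z => character (1 : ℝ) (innerSL ℝ (a z) (b z))).HasTemperateGrowth :=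
    (hasTemperateGrowth_character (1 : ℝ)).comp
      ((innerSL ℝ (E := V)).bilinear_hasTemperateGrowth ha hb)
  convert key using 2 with z
  simp only [character, innerSL_apply_apply, Real.inner_apply, one_mul]

variable [FiniteDimensional ℝ V] [MeasurableSpace V] [BorelSpace V]

theorem partialFourier_eq_integral_character (Ψ : 𝓢(V × V, ℂ)) (x t : V) :
    partialFourier Ψ (x, t) = ∫ ξ, character (-ξ) t * Ψ (x, ξ) := by
  rw [partialFourier_apply]
  refine integral_congr_ae (.of_forall fun ξ => ?_)
  simp only [character, inner_neg_left, Complex.ofReal_neg, mul_neg, neg_mul]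

theorem integral_character_mul_partialFourier (Ψ : 𝓢(V × V, ℂ)) (x t : V) :
    ∫ ξ, character ξ t * partialFourier Ψ (x, ξ) = Ψ (x, t) := by
  have inversion : 𝓕⁻ (𝓕 (sliceCLM x Ψ)) t = Ψ (x, t) := by
    rw [FourierTransform.fourierInv_fourier_eq, sliceCLM_apply]
  rw [← inversion, fourierInv_coe, Real.fourierInv_eq']
  refine integral_congr_ae (.of_forall fun ξ => ?_)
  change _ * _ = _ * _
  congr 1
  rw [character]
  push_cast
  ring_nf

end Character

section ChangeOfWindow

variable {V : Type*} [NormedAddCommGroup V] [InnerProductSpace ℝ V]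

/-- The linear involution `(y, t) ↦ (t - y, t)`, which turns `conj g ⊗ φ` into the integrand
`conj (g (t - y)) * φ t` of the short-time Fourier transform. -/
def reflectShear : (V × V) ≃L[ℝ] (V × V) :=
  ContinuousLinearEquiv.equivOfInverse
    ((ContinuousLinearMap.snd ℝ V V - ContinuousLinearMap.fst ℝ V V).prod
      (ContinuousLinearMap.snd ℝ V V))
    ((ContinuousLinearMap.snd ℝ V V - ContinuousLinearMap.fst ℝ V V).prod
      (ContinuousLinearMap.snd ℝ V V))
    (fun z => by ext <;> simp) (fun z => by ext <;> simp)

/-- The linear shear `((y, η), t) ↦ ((y, η), t - y)`, which turns `S ⊗ g` into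
`S (y, η) * g (t - y)`. -/
def shiftShear : ((V × V) × V) ≃L[ℝ] ((V × V) × V) :=
  ContinuousLinearEquiv.equivOfInverse
    ((ContinuousLinearMap.fst ℝ (V × V) V).prod (ContinuousLinearMap.snd ℝ (V × V) V
      - (ContinuousLinearMap.fst ℝ V V).comp (ContinuousLinearMap.fst ℝ (V × V) V)))
    ((ContinuousLinearMap.fst ℝ (V × V) V).prod (ContinuousLinearMap.snd ℝ (V × V) V
      + (ContinuousLinearMap.fst ℝ V V).comp (ContinuousLinearMap.fst ℝ (V × V) V)))
    (fun z => by ext <;> simp) (fun z => by ext <;> simp)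

variable [FiniteDimensional ℝ V]

/-- The Schwartz function `((y, η), t) ↦ S (y, η) * (M_η T_y g) t`: the time-frequency shifts of
`g` with coefficients `S`, as a Schwartz function of all variables at once. -/
noncomputable def shiftSchwartz (S : 𝓢(V × V, ℂ)) (g : 𝓢(V, ℂ)) : 𝓢((V × V) × V, ℂ) :=
  smulLeftCLM ℂ (fun z : (V × V) × V => character z.1.2 z.2)
    (compCLMOfContinuousLinearEquiv ℂ shiftShear (tensorSchwartz S g))

theorem shiftSchwartz_apply (S : 𝓢(V × V, ℂ)) (g : 𝓢(V, ℂ)) (z : V × V) (t : V) :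
    shiftSchwartz S g (z, t) = S z * timeFreqShift z.1 z.2 g t := by
  have h : (fun z : (V × V) × V => character z.1.2 z.2).HasTemperateGrowth :=
    hasTemperateGrowth_character_comp
      ((ContinuousLinearMap.snd ℝ V V).comp
        (ContinuousLinearMap.fst ℝ (V × V) V)).hasTemperateGrowth
      (ContinuousLinearMap.snd ℝ (V × V) V).hasTemperateGrowth
  rw [shiftSchwartz, smulLeftCLM_apply_apply h, timeFreqShift_apply]
  change _ * tensorSchwartz S g (z, t - z.1) = _
  rw [tensorSchwartz_apply]
  ring

theorem distrib_slice_conj_shiftSchwartz (F : 𝓢'(V, ℂ)) (S : 𝓢(V × V, ℂ)) (g : 𝓢(V, ℂ))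
    (z : V × V) : F (sliceCLM z (conjSchwartz (shiftSchwartz S g)))
      = starRingEnd ℂ (S z) * stft g F z.1 z.2 := by
  have hslice : sliceCLM z (conjSchwartz (shiftSchwartz S g))
      = starRingEnd ℂ (S z) • conjSchwartz (timeFreqShift z.1 z.2 g) := by
    ext t
    simp [shiftSchwartz_apply]
  rw [hslice, map_smul, smul_eq_mul, stft]

theorem continuous_stft (g : 𝓢(V, ℂ)) (F : 𝓢'(V, ℂ)) :
    Continuous fun z : V × V => stft g F z.1 z.2 := by
  refine continuous_iff_continuousAt.2 fun z₀ => ?_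
  obtain ⟨χ, -, hc, hs, -, hχz₀⟩ := exists_contDiff_tsupport_subset (n := ⊤)
    (Filter.univ_mem (f := nhds z₀))
  have hcχ : HasCompactSupport fun z => (χ z : ℂ) := hc.comp_left (g := Complex.ofReal) (by simp)
  let S : 𝓢(V × V, ℂ) := hcχ.toSchwartzMap (Complex.ofRealCLM.contDiff.comp hs)
  have hS : ∀ z, S z = χ z := fun z => rfl
  have hcontract : ∀ z, contractSnd F (conjSchwartz (shiftSchwartz S g)) z
      = χ z * stft g F z.1 z.2 := fun z => by
    rw [contractSnd_apply, distrib_slice_conj_shiftSchwartz, hS, Complex.conj_ofReal]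
  have hχ : ContinuousAt (fun z => (χ z : ℂ)) z₀ :=
    (Complex.continuous_ofReal.comp hs.continuous).continuousAt
  have hne : (χ z₀ : ℂ) ≠ 0 := by simp [hχz₀]
  refine ((SchwartzMap.continuous
    (contractSnd F (conjSchwartz (shiftSchwartz S g)))).continuousAt.div hχ hne).congr ?_
  filter_upwards [hχ.eventually_ne hne] with z hz
  rw [Pi.div_apply, hcontract, mul_div_cancel_left₀ _ hz]

variable [MeasurableSpace V] [BorelSpace V]

instance : (volume : Measure (V × V)).HasTemperateGrowth := by
  rw [Measure.volume_eq_prod]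
  infer_instance

/-- The short-time Fourier transform of a Schwartz function, as a Schwartz function. -/
noncomputable def stftSchwartz (g φ : 𝓢(V, ℂ)) : 𝓢(V × V, ℂ) :=
  partialFourier
    (compCLMOfContinuousLinearEquiv ℂ reflectShear (tensorSchwartz (conjSchwartz g) φ))

theorem stftSchwartz_apply (g φ : 𝓢(V, ℂ)) (y η : V) :
    stftSchwartz g φ (y, η)
      = ∫ t, character (-t) η * (starRingEnd ℂ (g (t - y)) * φ t) :=
  partialFourier_eq_integral_character _ _ _

theorem integral_character_mul_stftSchwartz (g φ : 𝓢(V, ℂ)) (y t : V) :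
    ∫ η, character η t * stftSchwartz g φ (y, η) = starRingEnd ℂ (g (t - y)) * φ t :=
  integral_character_mul_partialFourier _ _ _

theorem norm_stftSchwartz_timeFreqShift (g γ : 𝓢(V, ℂ)) (x ξ y η : V) :
    ‖stftSchwartz g (timeFreqShift x ξ γ) (y, η)‖ = ‖stftSchwartz g γ (y - x, η - ξ)‖ := by
  rw [stftSchwartz_apply, stftSchwartz_apply, ← integral_add_right_eq_self _ x]
  have phase : ∀ t, character (-(t + x)) η * (starRingEnd ℂ (g (t + x - y)) *
        timeFreqShift x ξ γ (t + x))
      = character (-x) η * character ξ x * (character (-t) (η - ξ) *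
        (starRingEnd ℂ (g (t - (y - x))) * γ t)) := fun t => by
    rw [timeFreqShift_apply, neg_add, character_add_left, character_add_right, sub_eq_add_neg η,
      character_add_right (-t), show t - (y - x) = t + x - y by abel, add_sub_cancel_right,
      character_neg_right (-t), neg_neg, character_comm t ξ]
    ring
  simp_rw [phase]
  rw [integral_const_mul, norm_mul, norm_mul, norm_character, norm_character, one_mul, one_mul]

/-- Inversion formula: `φ` is the superposition of the time-frequency shifts of `g` with
coefficients the short-time Fourier transform of `φ`. -/
theorem integral_shiftSchwartz (g φ : 𝓢(V, ℂ)) (t : V) :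
    ∫ z : V × V, shiftSchwartz (stftSchwartz g φ) g (z, t) = (∫ u, ‖g u‖ ^ 2 : ℝ) * φ t := by
  have hint : Integrable fun z : V × V => shiftSchwartz (stftSchwartz g φ) g (z, t) :=
    (sliceCLM t (compCLMOfContinuousLinearEquiv ℂ
      (ContinuousLinearEquiv.prodComm ℝ V (V × V))
        (shiftSchwartz (stftSchwartz g φ) g))).integrable
  rw [Measure.volume_eq_prod, integral_prod _ hint]
  have inner_integral : ∀ y, ∫ η, shiftSchwartz (stftSchwartz g φ) g ((y, η), t)
      = ((‖g (t - y)‖ ^ 2 : ℝ) : ℂ) * φ t := fun y => by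
    have regroup : ∀ η, shiftSchwartz (stftSchwartz g φ) g ((y, η), t)
        = (character η t * stftSchwartz g φ (y, η)) * g (t - y) := fun η => by
      rw [shiftSchwartz_apply, timeFreqShift_apply]
      ring
    simp_rw [regroup]
    rw [integral_mul_const, integral_character_mul_stftSchwartz, ← Complex.normSq_eq_norm_sq,
      Complex.normSq_eq_conj_mul_self]
    ring
  simp_rw [inner_integral]
  rw [integral_mul_const, integral_complex_ofReal,
    integral_sub_left_eq_self (fun u => ‖g u‖ ^ 2) volume t]

theorem integral_stftSchwartz_mul_stft (g φ : 𝓢(V, ℂ)) (F : 𝓢'(V, ℂ)) :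
    ((∫ u, ‖g u‖ ^ 2 : ℝ) : ℂ) * F (conjSchwartz φ)
      = ∫ z : V × V, starRingEnd ℂ (stftSchwartz g φ z) * stft g F z.1 z.2 := by
  rw [← smul_eq_mul, ← map_smul, distrib_integral_eq (μ := (volume : Measure (V × V))) F
    (Θ := conjSchwartz (shiftSchwartz (stftSchwartz g φ) g))]
  · simp_rw [distrib_slice_conj_shiftSchwartz]
  · intro t
    simp only [conjSchwartz_apply]
    rw [integral_conj, integral_shiftSchwartz]
    simp

theorem integral_norm_sq_pos {g : 𝓢(V, ℂ)} (hg : g ≠ 0) : 0 < ∫ u, ‖g u‖ ^ 2 := by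
  have hint : Integrable fun u => ‖g u‖ ^ 2 := by
    simpa using (g.memLp 2).integrable_norm_pow (by norm_num)
  obtain ⟨u, hu⟩ : ∃ u, g u ≠ 0 := by
    by_contra! h
    exact hg (SchwartzMap.ext h)
  refine (integral_pos_iff_support_of_nonneg (fun _ => by positivity) hint).2 ?_
  refine IsOpen.measure_pos _ ?_ ⟨u, by simpa using hu⟩
  exact (g.continuous.norm.pow 2).isOpen_support

theorem enorm_stft_le_lconvolution (g γ : 𝓢(V, ℂ)) (F : 𝓢'(V, ℂ)) (z : V × V) :
    ENNReal.ofReal (∫ u, ‖g u‖ ^ 2) * ‖stft γ F z.1 z.2‖ₑ ≤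
      ((fun w : V × V => ‖stft g F w.1 w.2‖ₑ) ⋆ₗ[volume]
        fun w => ‖stftSchwartz g γ (-w)‖ₑ) z := by
  have hnonneg : 0 ≤ ∫ u, ‖g u‖ ^ 2 := integral_nonneg fun _ => by positivity
  rw [lconvolution_def]
  calc ENNReal.ofReal (∫ u, ‖g u‖ ^ 2) * ‖stft γ F z.1 z.2‖ₑ
      = ‖((∫ u, ‖g u‖ ^ 2 : ℝ) : ℂ) * F (conjSchwartz (timeFreqShift z.1 z.2 γ))‖ₑ := by
        rw [enorm_mul, stft, ← ofReal_norm (Complex.ofReal _), Complex.norm_real,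
          Real.norm_of_nonneg hnonneg]
    _ ≤ ∫⁻ w : V × V, ‖starRingEnd ℂ (stftSchwartz g (timeFreqShift z.1 z.2 γ) w) *
          stft g F w.1 w.2‖ₑ := by
        rw [integral_stftSchwartz_mul_stft]
        exact enorm_integral_le_lintegral_enorm _
    _ = ∫⁻ w : V × V, ‖stft g F w.1 w.2‖ₑ * ‖stftSchwartz g γ (-(-w + z))‖ₑ := by
        refine lintegral_congr fun w => ?_
        rw [enorm_mul, mul_comm, neg_add, neg_neg, ← sub_eq_add_neg,
          ← ofReal_norm (starRingEnd ℂ _), ← ofReal_norm (stftSchwartz g γ _), RCLike.norm_conj,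
          norm_stftSchwartz_timeFreqShift]
        rfl

end ChangeOfWindow

section Moderate

theorem japaneseBracket_nonneg {V : Type*} [NormedAddCommGroup V] (s : ℝ) (z : V) :
    0 ≤ japaneseBracket s z := by
  rw [japaneseBracket]
  positivity

theorem continuous_japaneseBracket {V : Type*} [NormedAddCommGroup V] (s : ℝ) :
    Continuous (japaneseBracket s : V → ℝ) := by
  unfold japaneseBracket
  exact Continuous.rpow_const (by fun_prop) fun z => Or.inl (by positivity)

variable {V : Type*} [NormedAddCommGroup V] {s : ℝ}

theorem one_le_japaneseBracket (hs : 0 ≤ s) (z : V) : 1 ≤ japaneseBracket s z :=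
  Real.one_le_rpow (by nlinarith [norm_nonneg z]) (by positivity)

theorem japaneseBracket_add_le_mul (hs : 0 ≤ s) (a b : V) :
    japaneseBracket s (a + b) ≤ 2 ^ (s / 2) * (japaneseBracket s a * japaneseBracket s b) := by
  simp only [japaneseBracket]
  rw [← Real.mul_rpow (by positivity) (by positivity), ← Real.mul_rpow (by positivity)
    (by positivity)]
  refine Real.rpow_le_rpow (by positivity) ?_ (by positivity)
  have hsq : ‖a + b‖ ^ 2 ≤ (‖a‖ + ‖b‖) ^ 2 := by gcongr; exact norm_add_le a b
  nlinarith [sq_nonneg (‖a‖ - ‖b‖), mul_nonneg (sq_nonneg ‖a‖) (sq_nonneg ‖b‖)]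

theorem japaneseBracket_add_le_add (hs : 0 ≤ s) (a b : V) :
    japaneseBracket s (a + b) ≤ 2 ^ s * (japaneseBracket s a + japaneseBracket s b) := by
  have of_norm_le : ∀ {a b : V}, ‖a‖ ≤ ‖b‖ →
      japaneseBracket s (a + b) ≤ 2 ^ s * japaneseBracket s b := fun {a b} hab => by
    have hsum : ‖a + b‖ ≤ 2 * ‖b‖ := (norm_add_le a b).trans (by linarith)
    simp only [japaneseBracket]
    rw [show (2 : ℝ) ^ s = (2 ^ 2) ^ (s / 2) by
      rw [← Real.rpow_natCast, ← Real.rpow_mul (by norm_num)]; congr 1; push_cast; ring,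
      ← Real.mul_rpow (by positivity) (by positivity)]
    refine Real.rpow_le_rpow (by positivity) ?_ (by positivity)
    nlinarith [pow_le_pow_left₀ (norm_nonneg _) hsum 2]
  rw [mul_add]
  have hpow : (0 : ℝ) ≤ 2 ^ s := by positivity
  rcases le_total ‖a‖ ‖b‖ with h | h
  · linarith [of_norm_le h, mul_nonneg hpow (japaneseBracket_nonneg s a)]
  · rw [add_comm a b]
    linarith [of_norm_le h, mul_nonneg hpow (japaneseBracket_nonneg s b)]

theorem japaneseBracket_le_pow (hs : 0 ≤ s) (z : V) :
    japaneseBracket s z ≤ (1 + ‖z‖) ^ ⌈s⌉₊ := by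
  calc japaneseBracket s z ≤ ((1 + ‖z‖) ^ 2) ^ (s / 2) := by
        rw [japaneseBracket]
        refine Real.rpow_le_rpow (by positivity) ?_ (by positivity)
        nlinarith [norm_nonneg z]
    _ = (1 + ‖z‖) ^ s := by
        rw [← Real.rpow_natCast, ← Real.rpow_mul (by positivity)]
        congr 1
        push_cast
        ring
    _ ≤ (1 + ‖z‖) ^ (⌈s⌉₊ : ℝ) :=
        Real.rpow_le_rpow_of_exponent_le (by linarith [norm_nonneg z]) (Nat.le_ceil s)
    _ = (1 + ‖z‖) ^ ⌈s⌉₊ := Real.rpow_natCast _ _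

/-- Continuous weights on phase space that are moderate with respect to a polynomial weight. -/
structure IsModerate (m : V → V → ℝ) : Prop where
  nonneg (x ξ : V) : 0 ≤ m x ξ
  continuous : Continuous fun z : V × V => m z.1 z.2
  exists_le : ∃ (N : ℕ) (C : ℝ≥0), ∀ z w : V × V,
    m (z.1 + w.1) (z.2 + w.2) ≤ m z.1 z.2 * (C * (1 + ‖w‖) ^ N)

theorem isModerate_oneWeight : IsModerate (oneWeight : V → V → ℝ) where
  nonneg _ _ := zero_le_one
  continuous := continuous_const
  exists_le := ⟨0, 1, by simp [oneWeight]⟩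

theorem isModerate_japaneseBracket_comp [NormedSpace ℝ V] {W : Type*} [NormedAddCommGroup W]
    [NormedSpace ℝ W] (hs : 0 ≤ s) (L : V × V →L[ℝ] W) :
    IsModerate fun x ξ => japaneseBracket s (L (x, ξ)) where
  nonneg _ _ := japaneseBracket_nonneg _ _
  continuous := (continuous_japaneseBracket s).comp L.continuous
  exists_le := by
    have hC : (0 : ℝ) ≤ 2 ^ (s / 2) * (1 + ‖L‖) ^ ⌈s⌉₊ := by positivity
    refine ⟨⌈s⌉₊, ⟨_, hC⟩, fun z w => ?_⟩
    have hL : 1 + ‖L w‖ ≤ (1 + ‖L‖) * (1 + ‖w‖) := by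
      nlinarith [L.le_opNorm w, norm_nonneg L, norm_nonneg w]
    change japaneseBracket s (L (z + w)) ≤
      japaneseBracket s (L z) * (2 ^ (s / 2) * (1 + ‖L‖) ^ ⌈s⌉₊ * (1 + ‖w‖) ^ ⌈s⌉₊)
    calc japaneseBracket s (L (z + w))
        ≤ 2 ^ (s / 2) * (japaneseBracket s (L z) * japaneseBracket s (L w)) := by
          rw [map_add]
          exact japaneseBracket_add_le_mul hs _ _
      _ ≤ 2 ^ (s / 2) * (japaneseBracket s (L z) * ((1 + ‖L‖) * (1 + ‖w‖)) ^ ⌈s⌉₊) := by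
          gcongr
          · exact japaneseBracket_nonneg _ _
          · exact (japaneseBracket_le_pow hs _).trans (by gcongr)
      _ = _ := by
          rw [mul_pow]
          ring

theorem isModerate_oneTensorWeight [NormedSpace ℝ V] (hs : 0 ≤ s) :
    IsModerate (oneTensorWeight s : V → V → ℝ) :=
  isModerate_japaneseBracket_comp hs (ContinuousLinearMap.snd ℝ V V)

theorem isModerate_vWeight [NormedSpace ℝ V] (hs : 0 ≤ s) :
    IsModerate (vWeight s : V → V → ℝ) :=
  isModerate_japaneseBracket_comp hs
    (WithLp.prodContinuousLinearEquiv 2 ℝ V V).symm.toContinuousLinearMap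

end Moderate

section WindowChange

theorem exists_enorm_mul_pow_le {V W : Type*} [NormedAddCommGroup V] [NormedSpace ℝ V]
    [NormedAddCommGroup W] [NormedSpace ℝ W] (S : 𝓢(V × W, ℂ)) (N k l : ℕ) :
    ∃ K : ℝ≥0, ∀ z : V × W, ‖S z‖ₑ * ENNReal.ofReal ((1 + ‖z‖) ^ N)
      ≤ K * (‖(1 + ‖z.1‖) ^ (-k : ℝ)‖ₑ * ‖(1 + ‖z.2‖) ^ (-l : ℝ)‖ₑ) := by
  set n := N + k + l
  set K : ℝ := 2 ^ n * ((Finset.Iic (n, 0)).sup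
    fun m => SchwartzMap.seminorm ℂ (E := V × W) (F := ℂ) m.1 m.2) S
  have hK : 0 ≤ K := by positivity
  refine ⟨K.toNNReal, fun z => ?_⟩
  have decay := SchwartzMap.one_add_le_sup_seminorm_apply (𝕜 := ℂ) (m := (n, 0))
    (k := n) (n := 0) le_rfl le_rfl S z
  rw [norm_iteratedFDeriv_zero] at decay
  rw [← ofReal_norm, ← ENNReal.ofReal_mul (norm_nonneg _), ← enorm_mul,
    Real.enorm_of_nonneg (by positivity), ← ENNReal.ofReal, ← ENNReal.ofReal_mul hK]
  refine ENNReal.ofReal_le_ofReal ?_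
  rw [Real.rpow_neg (by positivity), Real.rpow_neg (by positivity),
    Real.rpow_natCast, Real.rpow_natCast, ← mul_inv, ← div_eq_mul_inv,
    le_div_iff₀ (by positivity)]
  refine le_trans ?_ decay
  calc ‖S z‖ * (1 + ‖z‖) ^ N * ((1 + ‖z.1‖) ^ k * (1 + ‖z.2‖) ^ l)
      ≤ ‖S z‖ * (1 + ‖z‖) ^ N * ((1 + ‖z‖) ^ k * (1 + ‖z‖) ^ l) := by
        gcongr
        · exact norm_fst_le z
        · exact norm_snd_le z
    _ = (1 + ‖z‖) ^ n * ‖S z‖ := by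
        simp only [n, pow_add]
        ring

theorem eLpqNorm_schwartz_mul_pow_lt_top {V W : Type*} [NormedAddCommGroup V] [NormedSpace ℝ V]
    [MeasurableSpace V] [NormedAddCommGroup W] [NormedSpace ℝ W] [MeasurableSpace W]
    (μ : Measure V) [μ.HasTemperateGrowth] (ν : Measure W) [ν.HasTemperateGrowth]
    (S : 𝓢(V × W, ℂ)) (N : ℕ) (p q : ℝ≥0∞) :
    eLpqNorm (fun z => ‖S z‖ₑ * ENNReal.ofReal ((1 + ‖z‖) ^ N)) p q μ ν < ∞ := by
  obtain ⟨k, hk⟩ := Measure.HasTemperateGrowth.exists_eLpNorm_lt_top p (μ := μ) inferInstance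
  obtain ⟨l, hl⟩ := Measure.HasTemperateGrowth.exists_eLpNorm_lt_top q (μ := ν) inferInstance
  obtain ⟨K, hK⟩ := exists_enorm_mul_pow_le S N k l
  have product_lt_top := eLpqNorm_mul_lt_top hk hl
  refine (eLpqNorm_le_const_mul hK p q).trans_lt ?_
  exact ENNReal.mul_lt_top ENNReal.coe_lt_top product_lt_top

variable {V : Type*} [NormedAddCommGroup V] [InnerProductSpace ℝ V] [FiniteDimensional ℝ V]

/-- The weighted short-time Fourier transform `|V_g F| m` as a function on `V × V`, with values in
`ℝ≥0∞` so that no integrability has to be discussed. -/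
noncomputable def weightedSTFT (g : 𝓢(V, ℂ)) (m : V → V → ℝ) (F : 𝓢'(V, ℂ)) (z : V × V) : ℝ≥0∞ :=
  ‖stft g F z.1 z.2‖ₑ * ENNReal.ofReal (m z.1 z.2)

theorem measurable_weightedSTFT [MeasurableSpace V] [OpensMeasurableSpace (V × V)]
    (g : 𝓢(V, ℂ)) (F : 𝓢'(V, ℂ)) {m : V → V → ℝ} (hm : IsModerate m) :
    Measurable (weightedSTFT g m F) :=
  (continuous_stft g F).measurable.enorm.mul hm.continuous.measurable.ennreal_ofReal

variable [MeasurableSpace V] [BorelSpace V]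

theorem modulationNorm_eq_eLpqNorm (g : 𝓢(V, ℂ)) (F : 𝓢'(V, ℂ)) {m : V → V → ℝ}
    (hm : IsModerate m) (p q : ℝ≥0∞) :
    modulationNorm g p q m F = eLpqNorm (weightedSTFT g m F) p q volume volume := by
  have henorm : ∀ x ξ, weightedSTFT g m F (x, ξ) = ‖stft g F x ξ * (m x ξ : ℂ)‖ₑ := fun x ξ => by
    rw [weightedSTFT, enorm_mul, ← ofReal_norm (m x ξ : ℂ), Complex.norm_real,
      Real.norm_of_nonneg (hm.nonneg x ξ)]
  simp only [eLpqNorm, henorm, eLpNorm_enorm]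
  rfl

/-- The kernel whose convolution with `|V_g F|` dominates `|V_γ F|`, with the polynomial growth
`(1 + ‖w‖) ^ N` of a moderate weight built in. -/
noncomputable def windowKernel (g γ : 𝓢(V, ℂ)) (N : ℕ) (w : V × V) : ℝ≥0∞ :=
  ‖stftSchwartz g γ (-w)‖ₑ * ENNReal.ofReal ((1 + ‖w‖) ^ N)

theorem measurable_windowKernel (g γ : 𝓢(V, ℂ)) (N : ℕ) : Measurable (windowKernel g γ N) :=
  ((stftSchwartz g γ).continuous.comp continuous_neg).measurable.enorm.mul
    (Continuous.measurable (by fun_prop)).ennreal_ofReal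

theorem eLpqNorm_windowKernel_lt_top (g γ : 𝓢(V, ℂ)) (N : ℕ) (p q : ℝ≥0∞) :
    eLpqNorm (windowKernel g γ N) p q volume volume < ∞ := by
  let reflected : 𝓢(V × V, ℂ) :=
    compCLMOfContinuousLinearEquiv ℂ (ContinuousLinearEquiv.neg ℝ) (stftSchwartz g γ)
  have kernel_eq : windowKernel g γ N =
      fun w => ‖reflected w‖ₑ * ENNReal.ofReal ((1 + ‖w‖) ^ N) := rfl
  rw [kernel_eq]
  exact eLpqNorm_schwartz_mul_pow_lt_top volume volume reflected N p q

theorem weightedSTFT_le_lconvolution (g γ : 𝓢(V, ℂ)) {m : V → V → ℝ} {N : ℕ} {C : ℝ≥0}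
    (hm : IsModerate m) (hmod : ∀ z w : V × V,
      m (z.1 + w.1) (z.2 + w.2) ≤ m z.1 z.2 * (C * (1 + ‖w‖) ^ N))
    (F : 𝓢'(V, ℂ)) (z : V × V) :
    ENNReal.ofReal (∫ u, ‖g u‖ ^ 2) * weightedSTFT γ m F z ≤
      C * (weightedSTFT g m F ⋆ₗ[volume] windowKernel g γ N) z := by
  have weight_le : ∀ w : V × V, ENNReal.ofReal (m z.1 z.2) ≤ ENNReal.ofReal (m w.1 w.2) *
      (C * ENNReal.ofReal ((1 + ‖-w + z‖) ^ N)) := fun w => by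
    rw [← ENNReal.ofReal_coe_nnreal, ← ENNReal.ofReal_mul NNReal.zero_le_coe,
      ← ENNReal.ofReal_mul (hm.nonneg _ _)]
    refine ENNReal.ofReal_le_ofReal ?_
    simpa using hmod w (-w + z)
  rw [weightedSTFT, ← mul_assoc]
  refine (mul_le_mul_left (enorm_stft_le_lconvolution g γ F z) _).trans ?_
  simp only [lconvolution_def, weightedSTFT, windowKernel]
  rw [← lintegral_mul_const' _ _ ENNReal.ofReal_ne_top,
    ← lintegral_const_mul' _ _ ENNReal.coe_ne_top]
  refine lintegral_mono fun w => ?_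
  refine (mul_le_mul_right (weight_le w) _).trans_eq ?_
  ring

theorem one_le_inv_one_add_inv_sub {p p' : ℝ≥0∞} (hpp : p ≤ p') :
    1 ≤ (1 + p'⁻¹ - p⁻¹)⁻¹ := by
  rw [ENNReal.one_le_inv, tsub_le_iff_right]
  gcongr

theorem inv_add_inv_inv_one_add_inv_sub {p : ℝ≥0∞} (hp : 1 ≤ p) (p' : ℝ≥0∞) :
    p⁻¹ + (1 + p'⁻¹ - p⁻¹)⁻¹⁻¹ = 1 + p'⁻¹ := by
  rw [inv_inv, add_tsub_cancel_of_le ((ENNReal.inv_le_one.2 hp).trans le_self_add)]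

/-- This contains both the inclusions between modulation spaces and their independence of the
window. -/
theorem exists_modulationNorm_le {g : 𝓢(V, ℂ)} (hg : g ≠ 0) (γ : 𝓢(V, ℂ)) {m : V → V → ℝ}
    (hm : IsModerate m) {p p' q q' : ℝ≥0∞} (hp : 1 ≤ p) (hpp : p ≤ p') (hq : 1 ≤ q)
    (hqq : q ≤ q') :
    ∃ K : ℝ≥0, ∀ F : 𝓢'(V, ℂ), modulationNorm γ p' q' m F ≤ K * modulationNorm g p q m F := by
  obtain ⟨N, C, hmod⟩ := hm.exists_le
  set D := (∫ u, ‖g u‖ ^ 2).toNNReal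
  have hD : D ≠ 0 := (Real.toNNReal_pos.2 (integral_norm_sq_pos hg)).ne'
  set kernelNorm :=
    eLpqNorm (windowKernel g γ N) (1 + p'⁻¹ - p⁻¹)⁻¹ (1 + q'⁻¹ - q⁻¹)⁻¹ volume volume
  have kernelNorm_lt_top : kernelNorm < ∞ := eLpqNorm_windowKernel_lt_top g γ N _ _
  refine ⟨D⁻¹ * C * kernelNorm.toNNReal, fun F => ?_⟩
  have young := eLpqNorm_lconvolution_le (μ := volume) (ν := volume) hp
    (one_le_inv_one_add_inv_sub hpp) (hp.trans hpp) hq (one_le_inv_one_add_inv_sub hqq)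
    (inv_add_inv_inv_one_add_inv_sub hp p') (inv_add_inv_inv_one_add_inv_sub hq q')
    (measurable_weightedSTFT g F hm) (measurable_windowKernel g γ N)
  have dominated : ∀ z, weightedSTFT γ m F z ≤
      (D⁻¹ * C : ℝ≥0) * (weightedSTFT g m F ⋆ₗ[volume] windowKernel g γ N) z := fun z => by
    rw [ENNReal.coe_mul, ENNReal.coe_inv hD, mul_assoc, ← ENNReal.div_eq_inv_mul,
      ENNReal.le_div_iff_mul_le (by simp [hD]) (by simp), mul_comm]
    exact weightedSTFT_le_lconvolution g γ hm hmod F z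
  rw [modulationNorm_eq_eLpqNorm γ F hm, modulationNorm_eq_eLpqNorm g F hm]
  refine (eLpqNorm_le_const_mul dominated p' q').trans ?_
  rw [ENNReal.coe_mul (D⁻¹ * C), ENNReal.coe_toNNReal kernelNorm_lt_top.ne, mul_assoc]
  gcongr
  exact young.trans_eq (mul_comm _ _)

end WindowChange

section SymplecticJ

variable {E : Type*} [NormedAddCommGroup E] [InnerProductSpace ℝ E]

/-- The standard symplectic matrix `J (x, ξ) = (ξ, -x)` of phase space. -/
noncomputable def symplecticJ : WithLp 2 (E × E) ≃ₗᵢ[ℝ] WithLp 2 (E × E) where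
  toFun ζ := WithLp.toLp 2 (ζ.snd, -ζ.fst)
  invFun ζ := WithLp.toLp 2 (-ζ.snd, ζ.fst)
  map_add' ζ η := WithLp.ofLp_injective 2 (by ext <;> simp [add_comm])
  map_smul' c ζ := WithLp.ofLp_injective 2 (by ext <;> simp)
  left_inv ζ := WithLp.ofLp_injective 2 (by ext <;> simp)
  right_inv ζ := WithLp.ofLp_injective 2 (by ext <;> simp)
  norm_map' ζ := by
    refine (sq_eq_sq₀ (norm_nonneg _) (norm_nonneg _)).1 ?_
    simp [WithLp.prod_norm_sq_eq_of_L2, add_comm]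

@[simp]
theorem symplecticJ_fst (ζ : WithLp 2 (E × E)) : (symplecticJ ζ).fst = ζ.snd := rfl

@[simp]
theorem symplecticJ_snd (ζ : WithLp 2 (E × E)) : (symplecticJ ζ).snd = -ζ.fst := rfl

theorem character_toLp (ζ : WithLp 2 (E × E)) (x ξ : E) :
    character ζ (WithLp.toLp 2 (x, ξ)) = character ζ.fst x * character ζ.snd ξ := by
  have hinner : inner ℝ ζ (WithLp.toLp 2 (x, ξ)) = inner ℝ ζ.fst x + inner ℝ ζ.snd ξ :=
    WithLp.prod_inner_apply _ _
  simp only [character, hinner, ← Complex.exp_add]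
  congr 1
  push_cast
  ring

theorem character_wigner_phase (z ζ : WithLp 2 (E × E)) (u v : E) :
    character (-z.snd) (u - v) * character (-ζ.fst) ((2⁻¹ : ℝ) • (u + v))
        * character (-ζ.snd) z.snd
      = character (-z.snd) ζ.snd * character (-(z - (2⁻¹ : ℝ) • symplecticJ ζ).snd) u
        * character (z + (2⁻¹ : ℝ) • symplecticJ ζ).snd v := by
  simp only [character, ← Complex.exp_add]
  congr 1
  simp only [WithLp.sub_snd, WithLp.add_snd, WithLp.smul_snd, symplecticJ_snd, inner_neg_left,
    inner_sub_left, inner_sub_right, inner_add_left, inner_add_right, real_inner_smul_left,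
    real_inner_smul_right, neg_sub, smul_neg]
  rw [real_inner_comm z.snd ζ.snd]
  push_cast
  ring

end SymplecticJ

section WignerWindow

variable {E : Type*} [NormedAddCommGroup E] [InnerProductSpace ℝ E] [FiniteDimensional ℝ E]

/-- The instantaneous correlation `(x, t) ↦ g(x + t/2) conj(g(x - t/2))` of `g`. -/
noncomputable def instCorrelation (g : 𝓢(E, ℂ)) : 𝓢(E × E, ℂ) :=
  compCLMOfContinuousLinearEquiv ℂ wignerCoord.symm (tensorSchwartz g (conjSchwartz g))

theorem instCorrelation_apply (g : 𝓢(E, ℂ)) (x t : E) :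
    instCorrelation g (x, t)
      = g (x + (2⁻¹ : ℝ) • t) * starRingEnd ℂ (g (x - (2⁻¹ : ℝ) • t)) :=
  rfl

variable [MeasurableSpace E] [BorelSpace E]

/-- The Wigner distribution `W(g, g)` of a Schwartz function, as a Schwartz function. -/
noncomputable def wignerWindow (g : 𝓢(E, ℂ)) : 𝓢(WithLp 2 (E × E), ℂ) :=
  compCLMOfContinuousLinearEquiv ℂ (WithLp.prodContinuousLinearEquiv 2 ℝ E E)
    (partialFourier (instCorrelation g))

theorem wignerWindow_toLp (g : 𝓢(E, ℂ)) (x ξ : E) :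
    wignerWindow g (WithLp.toLp 2 (x, ξ)) = partialFourier (instCorrelation g) (x, ξ) :=
  rfl

theorem wignerWindow_ne_zero {g : 𝓢(E, ℂ)} (hg : g ≠ 0) : wignerWindow g ≠ 0 := by
  intro hW
  refine hg (SchwartzMap.ext fun x => ?_)
  have partial_zero : ∀ ξ, partialFourier (instCorrelation g) (x, ξ) = 0 := fun ξ => by
    rw [← wignerWindow_toLp, hW, zero_apply]
  have inversion := integral_character_mul_partialFourier (instCorrelation g) x 0
  simpa [partial_zero, instCorrelation_apply] using inversion.symm

theorem wignerTranspose_apply_eq_integral_character (Ψ : 𝓢(WithLp 2 (E × E), ℂ)) (u v : E) :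
    wignerTranspose Ψ (u, v)
      = ∫ ξ, character (-ξ) (u - v) * Ψ (WithLp.toLp 2 ((2⁻¹ : ℝ) • (u + v), ξ)) :=
  partialFourier_eq_integral_character _ _ _

theorem conj_timeFreqShift_wignerWindow_toLp (g : 𝓢(E, ℂ)) (z ζ : WithLp 2 (E × E)) (x ξ : E) :
    conjSchwartz (timeFreqShift z ζ (wignerWindow g)) (WithLp.toLp 2 (x, ξ + z.snd))
      = character (-ζ.fst) x * character (-ζ.snd) (ξ + z.snd)
        * starRingEnd ℂ (partialFourier (instCorrelation g) (x - z.fst, ξ)) := by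
  have shift : WithLp.toLp 2 (x, ξ + z.snd) - z = WithLp.toLp 2 (x - z.fst, ξ) :=
    WithLp.ofLp_injective 2 (by ext <;> simp)
  simp only [conjSchwartz_apply, timeFreqShift_apply, shift, wignerWindow_toLp, character_toLp,
    map_mul, conj_character]

theorem wignerTranspose_conj_timeFreqShift (g : 𝓢(E, ℂ)) (z ζ : WithLp 2 (E × E))
    {a b : WithLp 2 (E × E)} (ha : a = z - (2⁻¹ : ℝ) • symplecticJ ζ)
    (hb : b = z + (2⁻¹ : ℝ) • symplecticJ ζ) (u v : E) :
    wignerTranspose (conjSchwartz (timeFreqShift z ζ (wignerWindow g))) (u, v)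
      = character (-z.snd) ζ.snd * conjSchwartz (timeFreqShift a.fst a.snd g) u
        * timeFreqShift b.fst b.snd g v := by
  set x := (2⁻¹ : ℝ) • (u + v) with hx
  have integrand_eq : ∀ ξ, character (-(ξ + z.snd)) (u - v) * conjSchwartz
        (timeFreqShift z ζ (wignerWindow g)) (WithLp.toLp 2 (x, ξ + z.snd))
      = (character (-z.snd) (u - v) * character (-ζ.fst) x * character (-ζ.snd) z.snd)
        * starRingEnd ℂ (character ξ (u - v + ζ.snd)
          * partialFourier (instCorrelation g) (x - z.fst, ξ)) := fun ξ => by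
    rw [conj_timeFreqShift_wignerWindow_toLp, map_mul, conj_character, neg_add,
      character_add_left, character_add_right (-ζ.snd), character_add_right (-ξ),
      character_comm (-ξ) ζ.snd, character_neg_right]
    ring
  have left_point : x - z.fst + (2⁻¹ : ℝ) • (u - v + ζ.snd) = u - a.fst := by
    simp only [hx, ha, WithLp.sub_fst, WithLp.smul_fst, symplecticJ_fst]
    module
  have right_point : x - z.fst - (2⁻¹ : ℝ) • (u - v + ζ.snd) = v - b.fst := by
    simp only [hx, hb, WithLp.add_fst, WithLp.smul_fst, symplecticJ_fst]
    module
  rw [wignerTranspose_apply_eq_integral_character, ← integral_add_right_eq_self _ z.snd]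
  simp_rw [← hx, integrand_eq]
  rw [integral_const_mul, integral_conj, integral_character_mul_partialFourier,
    character_wigner_phase, ← ha, ← hb, instCorrelation_apply, left_point, right_point]
  simp only [conjSchwartz_apply, timeFreqShift_apply, map_mul, conj_character, Complex.conj_conj]
  ring

theorem stft_crossWigner (g : 𝓢(E, ℂ)) (f₁ f₂ : 𝓢'(E, ℂ)) (z ζ : WithLp 2 (E × E))
    {a b : WithLp 2 (E × E)} (ha : a = z - (2⁻¹ : ℝ) • symplecticJ ζ)
    (hb : b = z + (2⁻¹ : ℝ) • symplecticJ ζ) :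
    stft (wignerWindow g) (crossWigner f₁ f₂) z ζ
      = character (-z.snd) ζ.snd * stft g f₁ a.fst a.snd
        * starRingEnd ℂ (stft g f₂ b.fst b.snd) := by
  set A := timeFreqShift a.fst a.snd g
  set B := timeFreqShift b.fst b.snd g
  set Ψ := wignerTranspose (conjSchwartz (timeFreqShift z ζ (wignerWindow g)))
  have slice_eq : ∀ u, sliceCLM u Ψ = (character (-z.snd) ζ.snd * conjSchwartz A u) • B :=
    fun u => by
      ext v
      rw [sliceCLM_apply, wignerTranspose_conj_timeFreqShift g z ζ ha hb]
      rfl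
  have contract_eq : contractSnd (conjDistrib f₂) Ψ =
      (character (-z.snd) ζ.snd * starRingEnd ℂ (f₂ (conjSchwartz B))) • conjSchwartz A := by
    ext u
    rw [contractSnd_apply, slice_eq, map_smul, conjDistrib_apply, smul_eq_mul,
      _root_.smul_apply, smul_eq_mul]
    ring
  rw [stft, crossWigner_apply, tensorDistrib_apply, contract_eq, map_smul, smul_eq_mul, stft, stft]
  ring

theorem enorm_stft_crossWigner (g : 𝓢(E, ℂ)) (f₁ f₂ : 𝓢'(E, ℂ)) (z ζ : WithLp 2 (E × E))
    {a b : WithLp 2 (E × E)} (ha : a = z - (2⁻¹ : ℝ) • symplecticJ ζ)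
    (hb : b = z + (2⁻¹ : ℝ) • symplecticJ ζ) :
    ‖stft (wignerWindow g) (crossWigner f₁ f₂) z ζ‖ₑ
      = ‖stft g f₁ a.fst a.snd‖ₑ * ‖stft g f₂ b.fst b.snd‖ₑ := by
  simp only [stft_crossWigner g f₁ f₂ z ζ ha hb, ← ofReal_norm, norm_mul, norm_character, one_mul,
    RCLike.norm_conj, ENNReal.ofReal_mul (norm_nonneg _)]

end WignerWindow

section WignerProduct

variable {E : Type*} [NormedAddCommGroup E] [InnerProductSpace ℝ E]

/-- The function `(z, ζ) ↦ A (z - Jζ/2) B (z + Jζ/2)`: applied to `|V_g f₁|` and `|V_g f₂|`, it is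
the modulus of the short-time Fourier transform of `W(f₁, f₂)` with window `W(g, g)`. -/
noncomputable def wignerProduct (A B : E × E → ℝ≥0∞)
    (w : WithLp 2 (E × E) × WithLp 2 (E × E)) : ℝ≥0∞ :=
  A (WithLp.ofLp (w.1 - (2⁻¹ : ℝ) • symplecticJ w.2)) *
    B (WithLp.ofLp (w.1 + (2⁻¹ : ℝ) • symplecticJ w.2))

variable [FiniteDimensional ℝ E] [MeasurableSpace E] [BorelSpace E]

theorem measurable_wignerProduct {A B : E × E → ℝ≥0∞} (hA : Measurable A) (hB : Measurable B) :
    Measurable (wignerProduct A B) := by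
  have measurable_ofLp := (WithLp.volume_preserving_ofLp E E).measurable
  have measurable_J := (symplecticJ (E := E)).continuous.measurable
  refine (hA.comp (measurable_ofLp.comp ?_)).mul (hB.comp (measurable_ofLp.comp ?_))
  · exact measurable_fst.sub ((measurable_J.comp measurable_snd).const_smul (2⁻¹ : ℝ))
  · exact measurable_fst.add ((measurable_J.comp measurable_snd).const_smul (2⁻¹ : ℝ))

theorem eLpNorm_wignerProduct_left {A B : E × E → ℝ≥0∞} (hA : Measurable A) (hB : Measurable B)
    (p : ℝ≥0∞) (ζ : WithLp 2 (E × E)) :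
    eLpNorm (fun z => wignerProduct A B (z, ζ)) p volume =
      eLpNorm (fun x => A x * B (x + WithLp.ofLp (symplecticJ ζ))) p volume := by
  set J := symplecticJ ζ
  have translate : MeasurePreserving (fun z => WithLp.ofLp (z - (2⁻¹ : ℝ) • J)) volume volume :=
    (WithLp.volume_preserving_ofLp E E).comp (measurePreserving_sub_right volume _)
  have hAB : Measurable fun x => A x * B (x + WithLp.ofLp J) :=
    hA.mul (hB.comp (measurable_add_const _))
  rw [← eLpNorm_comp_measurePreserving hAB.aestronglyMeasurable translate]
  congr 1
  funext z
  have half_add_half : z + (2⁻¹ : ℝ) • J = z - (2⁻¹ : ℝ) • J + J := by module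
  simp only [wignerProduct, Function.comp_apply, J, half_add_half, WithLp.ofLp_add]

theorem eLpqNorm_wignerProduct_le {p q p₁ p₂ q₁ q₂ : ℝ≥0∞} (h0 : p ≠ 0) (hpq : p ≤ q)
    (hp₁ : p ≤ p₁) (hp₂ : p ≤ p₂) (hq₁ : p ≤ q₁) (hq₂ : p ≤ q₂)
    (hpp : p₁⁻¹ + p₂⁻¹ = p⁻¹ + q⁻¹) (hqq : q₁⁻¹ + q₂⁻¹ = p⁻¹ + q⁻¹)
    {A B : E × E → ℝ≥0∞} (hA : Measurable A) (hB : Measurable B) :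
    eLpqNorm (wignerProduct A B) p q volume volume ≤
      eLpqNorm A p₁ q₁ volume volume * eLpqNorm B p₂ q₂ volume volume := by
  set N : E × E → ℝ≥0∞ := fun u => eLpNorm (fun x => A x * B (x + u)) p volume
  have measurable_N : Measurable N :=
    measurable_eLpNorm_left ((hA.comp measurable_fst).mul (hB.comp measurable_add)) p
  have rotate : MeasurePreserving (fun ζ => WithLp.ofLp (symplecticJ (E := E) ζ)) volume volume :=
    (WithLp.volume_preserving_ofLp E E).comp (symplecticJ (E := E)).measurePreserving
  calc eLpqNorm (wignerProduct A B) p q volume volume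
      = eLpNorm (fun ζ => N (WithLp.ofLp (symplecticJ ζ))) q volume := by
        simp only [eLpqNorm, eLpNorm_wignerProduct_left hA hB, N]
    _ = eLpNorm N q volume :=
        eLpNorm_comp_measurePreserving measurable_N.aestronglyMeasurable rotate
    _ = eLpqNorm N q q volume volume := (eLpqNorm_self measurable_N q).symm
    _ ≤ eLpqNorm A p₁ q₁ volume volume * eLpqNorm B p₂ q₂ volume volume :=
        eLpqNorm_eLpNorm_mul_comp_add_right_le h0 hp₁ hp₂ hq₁ hq₂ hpq hpp hqq hA hB

end WignerProduct

section CrossWigner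

variable {E : Type*} [NormedAddCommGroup E] [InnerProductSpace ℝ E] {s : ℝ}

theorem japaneseBracket_le_sub_add (hs : 0 ≤ s) (z ζ : WithLp 2 (E × E)) :
    japaneseBracket s ζ ≤ 2 ^ s * (japaneseBracket s (z - (2⁻¹ : ℝ) • symplecticJ ζ) +
      japaneseBracket s (z + (2⁻¹ : ℝ) • symplecticJ ζ)) := by
  set a := z - (2⁻¹ : ℝ) • symplecticJ ζ with ha
  set b := z + (2⁻¹ : ℝ) • symplecticJ ζ with hb
  have norm_eq : ‖-a + b‖ = ‖ζ‖ := by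
    rw [← symplecticJ.norm_map ζ, ha, hb]
    congr 1
    module
  simpa only [japaneseBracket, norm_eq, norm_neg] using japaneseBracket_add_le_add hs (-a) b

variable [FiniteDimensional ℝ E] [MeasurableSpace E] [BorelSpace E]

theorem weightedSTFT_crossWigner_le (hs : 0 ≤ s) (g : 𝓢(E, ℂ)) (f₁ f₂ : 𝓢'(E, ℂ))
    (w : WithLp 2 (E × E) × WithLp 2 (E × E)) :
    weightedSTFT (wignerWindow g) (oneTensorWeight s) (crossWigner f₁ f₂) w ≤
      ((2 : ℝ≥0) ^ s : ℝ≥0) *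
        (wignerProduct (weightedSTFT g oneWeight f₁) (weightedSTFT g (vWeight s) f₂) w +
          wignerProduct (weightedSTFT g (vWeight s) f₁) (weightedSTFT g oneWeight f₂) w) := by
  obtain ⟨z, ζ⟩ := w
  have two_rpow : (((2 : ℝ≥0) ^ s : ℝ≥0) : ℝ≥0∞) = ENNReal.ofReal (2 ^ s) := by
    rw [ENNReal.ofReal, Real.toNNReal_rpow_of_nonneg zero_le_two, Real.toNNReal_ofNat]
  have weight_le := ENNReal.ofReal_le_ofReal (japaneseBracket_le_sub_add hs z ζ)
  rw [ENNReal.ofReal_mul (by positivity), ENNReal.ofReal_add (japaneseBracket_nonneg _ _)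
    (japaneseBracket_nonneg _ _), ← two_rpow] at weight_le
  simp only [weightedSTFT, wignerProduct, oneTensorWeight, oneWeight, vWeight, ENNReal.ofReal_one,
    mul_one, enorm_stft_crossWigner g f₁ f₂ z ζ rfl rfl]
  exact (mul_le_mul_right weight_le _).trans_eq (by ring!)

theorem modulationNorm_wignerWindow_crossWigner_le {p q p₁ p₂ q₁ q₂ : ℝ≥0∞} (hp : 1 ≤ p)
    (hpq : p ≤ q) (hp₁ : p ≤ p₁) (hp₂ : p ≤ p₂) (hq₁ : p ≤ q₁) (hq₂ : p ≤ q₂)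
    (hpp : p₁⁻¹ + p₂⁻¹ = p⁻¹ + q⁻¹) (hqq : q₁⁻¹ + q₂⁻¹ = p⁻¹ + q⁻¹) (hs : 0 ≤ s)
    (g : 𝓢(E, ℂ)) (f₁ f₂ : 𝓢'(E, ℂ)) :
    modulationNorm (wignerWindow g) p q (oneTensorWeight s) (crossWigner f₁ f₂) ≤
      ((2 : ℝ≥0) ^ s : ℝ≥0) *
        (modulationNorm g p₁ q₁ oneWeight f₁ * modulationNorm g p₂ q₂ (vWeight s) f₂ +
          modulationNorm g p₁ q₁ (vWeight s) f₁ * modulationNorm g p₂ q₂ oneWeight f₂) := by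
  have h1 := isModerate_oneWeight (V := E)
  have hv := isModerate_vWeight (V := E) hs
  have product_le : ∀ {m m' : E → E → ℝ}, IsModerate m → IsModerate m' →
      eLpqNorm (wignerProduct (weightedSTFT g m f₁) (weightedSTFT g m' f₂)) p q volume volume ≤
        modulationNorm g p₁ q₁ m f₁ * modulationNorm g p₂ q₂ m' f₂ := fun hm hm' => by
    rw [modulationNorm_eq_eLpqNorm g f₁ hm, modulationNorm_eq_eLpqNorm g f₂ hm']
    exact eLpqNorm_wignerProduct_le (zero_lt_one.trans_le hp).ne' hpq hp₁ hp₂ hq₁ hq₂ hpp hqq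
      (measurable_weightedSTFT g f₁ hm) (measurable_weightedSTFT g f₂ hm')
  have measurable_product : ∀ {m m' : E → E → ℝ}, IsModerate m → IsModerate m' →
      Measurable (wignerProduct (weightedSTFT g m f₁) (weightedSTFT g m' f₂)) := fun hm hm' =>
    measurable_wignerProduct (measurable_weightedSTFT g f₁ hm) (measurable_weightedSTFT g f₂ hm')
  rw [modulationNorm_eq_eLpqNorm _ _ (isModerate_oneTensorWeight hs)]
  refine (eLpqNorm_le_const_mul (weightedSTFT_crossWigner_le hs g f₁ f₂) p q).trans ?_
  gcongr
  exact (eLpqNorm_add_le (measurable_product h1 hv) (measurable_product hv h1) hp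
    (hp.trans hpq)).trans (add_le_add (product_le h1 hv) (product_le hv h1))

theorem exists_exponents_of_le {p q r₁ r₂ : ℝ≥0∞} (hpq : p ≤ q) (h₁ : r₁ ≤ q) (h₂ : r₂ ≤ q)
    (h : p⁻¹ + q⁻¹ ≤ r₁⁻¹ + r₂⁻¹) :
    ∃ t₁ t₂, r₁ ≤ t₁ ∧ r₂ ≤ t₂ ∧ p ≤ t₁ ∧ p ≤ t₂ ∧ t₁⁻¹ + t₂⁻¹ = p⁻¹ + q⁻¹ := by
  set x := min r₁⁻¹ p⁻¹ with hx
  have le_x : q⁻¹ ≤ x := le_min (ENNReal.inv_le_inv.2 h₁) (ENNReal.inv_le_inv.2 hpq)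
  have sum_le : p⁻¹ + q⁻¹ ≤ x + r₂⁻¹ := by
    rcases min_choice r₁⁻¹ p⁻¹ with e | e <;> rw [hx, e]
    · exact h
    · gcongr
  refine ⟨x⁻¹, (p⁻¹ + q⁻¹ - x)⁻¹, ?_, ?_, ?_, ?_, ?_⟩
  · exact ENNReal.le_inv_iff_le_inv.2 (min_le_left _ _)
  · exact ENNReal.le_inv_iff_le_inv.2 (tsub_le_iff_left.2 sum_le)
  · exact ENNReal.le_inv_iff_le_inv.2 (min_le_right _ _)
  · rw [ENNReal.le_inv_iff_le_inv, tsub_le_iff_left, add_comm]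
    gcongr
  · rw [inv_inv, inv_inv, add_tsub_cancel_of_le ((min_le_right _ _).trans le_self_add)]

theorem exists_exponents {p q r₁ r₂ : ℝ≥0∞} (h₁ : r₁ ≤ q) (h₂ : r₂ ≤ q)
    (h : p⁻¹ + q⁻¹ ≤ r₁⁻¹ + r₂⁻¹) :
    ∃ t₁ t₂, r₁ ≤ t₁ ∧ r₂ ≤ t₂ ∧ min p q ≤ t₁ ∧ min p q ≤ t₂ ∧
      t₁⁻¹ + t₂⁻¹ = (min p q)⁻¹ + q⁻¹ := by
  refine exists_exponents_of_le (min_le_right p q) h₁ h₂ ?_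
  rcases min_choice p q with e | e <;> rw [e]
  · exact h
  · exact add_le_add (ENNReal.inv_le_inv.2 h₁) (ENNReal.inv_le_inv.2 h₂)

theorem exists_modulationNorm_le_and_le {g : 𝓢(E, ℂ)} (hg : g ≠ 0) {m m' : E → E → ℝ}
    (hm : IsModerate m) (hm' : IsModerate m') {p p' q q' : ℝ≥0∞} (hp : 1 ≤ p) (hpp : p ≤ p')
    (hq : 1 ≤ q) (hqq : q ≤ q') :
    ∃ K : ℝ≥0, ∀ f : 𝓢'(E, ℂ), modulationNorm g p' q' m f ≤ K * modulationNorm g p q m f ∧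
      modulationNorm g p' q' m' f ≤ K * modulationNorm g p q m' f := by
  obtain ⟨K, hK⟩ := exists_modulationNorm_le hg g hm hp hpp hq hqq
  obtain ⟨K', hK'⟩ := exists_modulationNorm_le hg g hm' hp hpp hq hqq
  refine ⟨max K K', fun f => ⟨(hK f).trans ?_, (hK' f).trans ?_⟩⟩ <;> gcongr
  · exact le_max_left K K'
  · exact le_max_right K K'

theorem modulationNorm_oneWeight_le (hs : 0 ≤ s) (g : 𝓢(E, ℂ)) (p q : ℝ≥0∞) (f : 𝓢'(E, ℂ)) :
    modulationNorm g p q oneWeight f ≤ modulationNorm g p q (vWeight s) f := by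
  rw [modulationNorm_eq_eLpqNorm g f isModerate_oneWeight,
    modulationNorm_eq_eLpqNorm g f (isModerate_vWeight hs)]
  refine eLpqNorm_mono (fun z => ?_) p q
  simp only [weightedSTFT]
  gcongr
  exact one_le_japaneseBracket hs _

theorem exists_modulationNorm_crossWigner_le {p₁ q₁ p₂ q₂ p q : ℝ≥0∞}
    (hp₁ : 1 ≤ p₁) (hq₁ : 1 ≤ q₁) (hp₂ : 1 ≤ p₂) (hq₂ : 1 ≤ q₂) (hp : 1 ≤ p)
    (hp₁q : p₁ ≤ q) (hq₁q : q₁ ≤ q) (hp₂q : p₂ ≤ q) (hq₂q : q₂ ≤ q)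
    (hpp : p⁻¹ + q⁻¹ ≤ p₁⁻¹ + p₂⁻¹) (hqq : p⁻¹ + q⁻¹ ≤ q₁⁻¹ + q₂⁻¹) (hs : 0 ≤ s)
    {g : 𝓢(E, ℂ)} (hg : g ≠ 0) (Φ : 𝓢(WithLp 2 (E × E), ℂ)) :
    ∃ C : ℝ≥0, ∀ f₁ f₂ : 𝓢'(E, ℂ),
      modulationNorm Φ p q (oneTensorWeight s) (crossWigner f₁ f₂) ≤
        C * (modulationNorm g p₁ q₁ oneWeight f₁ * modulationNorm g p₂ q₂ (vWeight s) f₂ +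
          modulationNorm g p₁ q₁ (vWeight s) f₁ * modulationNorm g p₂ q₂ oneWeight f₂) := by
  have hq : 1 ≤ q := hp₁.trans hp₁q
  obtain ⟨a₁, a₂, ha₁, ha₂, hma₁, hma₂, ha⟩ := exists_exponents hp₁q hp₂q hpp
  obtain ⟨b₁, b₂, hb₁, hb₂, hmb₁, hmb₂, hb⟩ := exists_exponents hq₁q hq₂q hqq
  obtain ⟨K, change_window⟩ := exists_modulationNorm_le (wignerWindow_ne_zero hg) Φ
    (isModerate_oneTensorWeight hs) (le_min hp hq) (min_le_left p q) hq le_rfl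
  obtain ⟨K₁, embed₁⟩ := exists_modulationNorm_le_and_le hg isModerate_oneWeight
    (isModerate_vWeight hs) hp₁ ha₁ hq₁ hb₁
  obtain ⟨K₂, embed₂⟩ := exists_modulationNorm_le_and_le hg isModerate_oneWeight
    (isModerate_vWeight hs) hp₂ ha₂ hq₂ hb₂
  refine ⟨K * (2 ^ s * (K₁ * K₂)), fun f₁ f₂ => ?_⟩
  calc modulationNorm Φ p q (oneTensorWeight s) (crossWigner f₁ f₂)
      ≤ K * modulationNorm (wignerWindow g) (min p q) q (oneTensorWeight s) (crossWigner f₁ f₂) :=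
        change_window _
    _ ≤ K * (((2 : ℝ≥0) ^ s : ℝ≥0) *
          (modulationNorm g a₁ b₁ oneWeight f₁ * modulationNorm g a₂ b₂ (vWeight s) f₂ +
            modulationNorm g a₁ b₁ (vWeight s) f₁ * modulationNorm g a₂ b₂ oneWeight f₂)) := by
        gcongr
        exact modulationNorm_wignerWindow_crossWigner_le (le_min hp hq) (min_le_right p q)
          hma₁ hma₂ hmb₁ hmb₂ ha hb hs g f₁ f₂
    _ ≤ K * (((2 : ℝ≥0) ^ s : ℝ≥0) *
          (K₁ * modulationNorm g p₁ q₁ oneWeight f₁ *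
              (K₂ * modulationNorm g p₂ q₂ (vWeight s) f₂) +
            K₁ * modulationNorm g p₁ q₁ (vWeight s) f₁ *
              (K₂ * modulationNorm g p₂ q₂ oneWeight f₂))) := by
        gcongr
        · exact (embed₁ f₁).1
        · exact (embed₂ f₂).2
        · exact (embed₁ f₁).2
        · exact (embed₂ f₂).1
    _ = _ := by
        simp only [ENNReal.coe_mul]
        ring

end CrossWigner

end TimeFreq

theorem theorem3p3_general {E : Type*} [NormedAddCommGroup E] [InnerProductSpace ℝ E]
    [FiniteDimensional ℝ E] [MeasurableSpace E] [BorelSpace E] {p₁ q₁ p₂ q₂ p q : ℝ≥0∞}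
    (hp₁ : 1 ≤ p₁) (hq₁ : 1 ≤ q₁) (hp₂ : 1 ≤ p₂) (hq₂ : 1 ≤ q₂) (hp : 1 ≤ p)
    (hp₁q : p₁ ≤ q) (hq₁q : q₁ ≤ q) (hp₂q : p₂ ≤ q) (hq₂q : q₂ ≤ q)
    (hpp : p⁻¹ + q⁻¹ ≤ p₁⁻¹ + p₂⁻¹) (hqq : p⁻¹ + q⁻¹ ≤ q₁⁻¹ + q₂⁻¹)
    {s : ℝ} (hs : 0 ≤ s) {g : 𝓢(E, ℂ)} (hg : g ≠ 0) (Φ : 𝓢(WithLp 2 (E × E), ℂ)) :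
    ∃ C : ℝ≥0, ∀ f₁ f₂ : 𝓢'(E, ℂ),
      f₁ ∈ TimeFreq.modulationSpace g p₁ q₁ (TimeFreq.vWeight s) →
      f₂ ∈ TimeFreq.modulationSpace g p₂ q₂ (TimeFreq.vWeight s) →
      TimeFreq.crossWigner f₁ f₂ ∈
          TimeFreq.modulationSpace Φ p q (TimeFreq.oneTensorWeight s) ∧
        TimeFreq.modulationNorm Φ p q (TimeFreq.oneTensorWeight s) (TimeFreq.crossWigner f₁ f₂) ≤
          C * (TimeFreq.modulationNorm g p₁ q₁ TimeFreq.oneWeight f₁ *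
                TimeFreq.modulationNorm g p₂ q₂ (TimeFreq.vWeight s) f₂ +
              TimeFreq.modulationNorm g p₁ q₁ (TimeFreq.vWeight s) f₁ *
                TimeFreq.modulationNorm g p₂ q₂ TimeFreq.oneWeight f₂) := by
  obtain ⟨C, norm_le⟩ := TimeFreq.exists_modulationNorm_crossWigner_le hp₁ hq₁ hp₂ hq₂ hp
    hp₁q hq₁q hp₂q hq₂q hpp hqq hs hg Φ
  refine ⟨C, fun f₁ f₂ hf₁ hf₂ => ⟨(norm_le f₁ f₂).trans_lt ?_, norm_le f₁ f₂⟩⟩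
  have hf₁' := (TimeFreq.modulationNorm_oneWeight_le hs g p₁ q₁ f₁).trans_lt hf₁
  have hf₂' := (TimeFreq.modulationNorm_oneWeight_le hs g p₂ q₂ f₂).trans_lt hf₂
  exact ENNReal.mul_lt_top ENNReal.coe_lt_top
    (ENNReal.add_lt_top.2 ⟨ENNReal.mul_lt_top hf₁' hf₂, ENNReal.mul_lt_top hf₁ hf₂'⟩)

theorem theorem3p3 (d : ℕ) (p₁ q₁ p₂ q₂ p q : ℝ≥0∞)
    (hp₁ : 1 ≤ p₁) (hq₁ : 1 ≤ q₁) (hp₂ : 1 ≤ p₂) (hq₂ : 1 ≤ q₂) (hp : 1 ≤ p) (hq : 1 ≤ q)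
    (hp₁q : p₁ ≤ q) (hq₁q : q₁ ≤ q) (hp₂q : p₂ ≤ q) (hq₂q : q₂ ≤ q)
    (hpp : p⁻¹ + q⁻¹ ≤ p₁⁻¹ + p₂⁻¹) (hqq : p⁻¹ + q⁻¹ ≤ q₁⁻¹ + q₂⁻¹)
    (s : ℝ) (hs : 0 ≤ s)
    (g : 𝓢(EuclideanSpace ℝ (Fin d), ℂ)) (hg : g ≠ 0)
    (Φ : 𝓢(WithLp 2 (EuclideanSpace ℝ (Fin d) × EuclideanSpace ℝ (Fin d)), ℂ)) (hΦ : Φ ≠ 0) :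
    ∃ C : ℝ≥0, ∀ f₁ f₂ : 𝓢'(EuclideanSpace ℝ (Fin d), ℂ),
      f₁ ∈ TimeFreq.modulationSpace g p₁ q₁ (TimeFreq.vWeight s) →
      f₂ ∈ TimeFreq.modulationSpace g p₂ q₂ (TimeFreq.vWeight s) →
      TimeFreq.crossWigner f₁ f₂ ∈
          TimeFreq.modulationSpace Φ p q (TimeFreq.oneTensorWeight s) ∧
        TimeFreq.modulationNorm Φ p q (TimeFreq.oneTensorWeight s) (TimeFreq.crossWigner f₁ f₂) ≤
          C * (TimeFreq.modulationNorm g p₁ q₁ TimeFreq.oneWeight f₁ *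
                TimeFreq.modulationNorm g p₂ q₂ (TimeFreq.vWeight s) f₂ +
              TimeFreq.modulationNorm g p₁ q₁ (TimeFreq.vWeight s) f₁ *
                TimeFreq.modulationNorm g p₂ q₂ TimeFreq.oneWeight f₂) := by
  exact theorem3p3_general hp₁ hq₁ hp₂ hq₂ hp hp₁q hq₁q hp₂q hq₂q hpp hqq hs hg Φ
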